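/- \textbf{Setting.} Fix an integer $k\ge 1$ (the number of pivots) and put $m=\lceil\frac{k+1}{2}\rceil$. The input is a uniformly random permutation $(e_1,\dots,e_n)$ of $\{1,\dots,n\}$, stored in an array $A[1..n]$, with $n>k$. The elements $e_1,\dots,e_k$ are the pivots; let $p_1<\dots<p_k$ be the pivots in sorted order, $p_0=0$, $p_{k+1}=n+1$. A non-pivot element $x$ belongs to group $\mathrm A_h$, $0\le h\le k$, if $p_h<x<p_{h+1}$. Group memberships are known for free. The operation $\mathtt{rotate}(i_1,\dots,i_\ell)$ performs $tmp\gets A[i_1];\ A[i_1]\gets A[i_2];\ \dots;\ A[i_{\ell-1}]\gets A[i_\ell];\ A[i_\ell]\gets tmp$; it makes $\ell$ write accesses (to array cells) and $\ell+1$ assignments. \textbf{Algorithm $\mathit{Exchange}_k$.} Set $\mathtt i\gets k+1$, $\mathtt j\gets n$, $\mathtt b_1,\dots,\mathtt b_{m-1}\gets k+1$ and $\mathtt b_m,\dots,\mathtt b_{k-1}\gets n$. While $\mathtt i<\mathtt j$, do the following: (1) while $A[\mathtt i]$ belongs to a group $\mathrm A_p$ with $p<m$: if $p<m-1$, perform $\mathtt{rotate}(\mathtt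 i,\mathtt b_{m-1},\dots,\mathtt b_{p+1})$ and then increment $\mathtt b_{p+1},\dots,\mathtt b_{m-1}$; in any case increment $\mathtt i$; (2) while $A[\mathtt j]$ belongs to a group $\mathrm A_q$ with $q\ge m$: if $q\ge m+1$, perform $\mathtt{rotate}(\mathtt j,\mathtt b_m,\dots,\mathtt b_{q-1})$ and then decrement $\mathtt b_m,\dots,\mathtt b_{q-1}$; in any case decrement $\mathtt j$; (3) if $\mathtt i<\mathtt j$, with $A[\mathtt i]$ in $\mathrm A_p$ and $A[\mathtt j]$ in $\mathrm A_q$: perform $\mathtt{rotate}(\mathtt i,\mathtt b_{m-1},\dots,\mathtt b_{q+1},\mathtt j,\mathtt b_m,\dots,\mathtt b_{p-1})$, then increment $\mathtt i,\mathtt b_{q+1},\dots,\mathtt b_{m-1}$ and decrement $\mathtt j,\mathtt b_m,\dots,\mathtt b_{p-1}$. (Pivot cells and positions outside the array belong to no group, so the inner loops end there.) \textbf{Cost measures.} A pointer with initial value $l_s$ and final value $l_e$ has cost $|l_s-l_e|$. The number $\mathrm P^{\mathrm{se}}_n$ of scanned elements is the sum of the costs of the pointers $\mathtt i,\mathtt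 j,\mathtt b_1,\dots,\mathtt b_{k-1}$; $\mathrm P^{\mathrm{wa}}_n$ and $\mathrm P^{\mathrm{as}}_n$ are the total numbers of write accesses and of assignments over all rotate operations performed by $\mathit{Exchange}_k$. \textbf{Theorem.} For every fixed $k\ge1$, as $n\to\infty$ (with the constants in $O(1)$ depending only on $k$), $$\mathrm E(\mathrm P^{\mathrm{se}}_n)=\begin{cases}\dfrac{m+1}{2}\,n+O(1),&k\text{ odd},\\[1.5ex]\dfrac{m^2}{2m-1}\,n+O(1),&k\text{ even},\end{cases}$$ $$\mathrm E(\mathrm P^{\mathrm{wa}}_n)=\begin{cases}\dfrac{2m^3+3m^2-m-2}{2m(2m+1)}\,n+O(1),&k\text{ odd},\\[1.5ex]\dfrac{2m^3-2m-1}{2m(2m-1)}\,n+O(1),&k\text{ even},\end{cases}$$ $$\mathrm E(\mathrm P^{\mathrm{as}}_n)=\begin{cases}\dfrac{2m^3+6m^2-m-4}{2m(2m+1)}\,n+O(1),&k\text{ odd},\\[1.5ex]\dfrac{2m^3+3m^2-5m-2}{2m(2m-1)}\,n+O(1),&k\text{ even}.\end{cases}$$ -/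

import Mathlib

namespace MultiPivot

/-- The arrays are indexed from `1` as in `A[1..n]`; the entry of a cell is the index `h` of the
group `A_h` to which the element in that cell belongs.
Loop of the operation `rotate`: for the remaining index list `x :: y :: l` perform `A[x] ← A[y]` and
go on with `y :: l`; for the last index `x` perform `A[x] ← tmp`. -/
def rotateAux (tmp : ℕ) : (ℕ → ℕ) → List ℕ → (ℕ → ℕ)
  | A, [] => A
  | A, [x] => Function.update A x tmp
  | A, x :: y :: l => rotateAux tmp (Function.update A x (A y)) (y :: l)

/-- `rotate(i₁,…,i_ℓ)`: `tmp ← A[i₁]; A[i₁] ← A[i₂]; …; A[i_{ℓ-1}] ← A[i_ℓ]; A[i_ℓ] ← tmp`. -/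
def rotate (A : ℕ → ℕ) : List ℕ → (ℕ → ℕ)
  | [] => A
  | x :: l => rotateAux (A x) A (x :: l)

/-- The memory of the algorithm: the array, the pointers `i` and `j`, the border pointers
`b 1, …, b (k - 1)`, and two counters for the costs of all `rotate` operations made so far. -/
structure State where
  A : ℕ → ℕ
  i : ℕ
  j : ℕ
  b : ℕ → ℕ
  writes : ℕ
  assigns : ℕ

namespace State

/-- Perform `rotate(l)`. With `ℓ` indices it makes `ℓ` write accesses and `ℓ + 1` assignments. -/
def rot (s : State) (l : List ℕ) : State :=
  { s with
    A := rotate s.A l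
    writes := s.writes + l.length
    assigns := s.assigns + (l.length + 1) }

/-- The list `b_{m-1}, …, b_{p+1}` of border pointer values (empty if `p ≥ m - 1`). -/
def leftBorders (s : State) (m p : ℕ) : List ℕ := ((List.Ico (p + 1) m).reverse).map s.b

/-- The list `b_m, …, b_{q-1}` of border pointer values (empty if `q ≤ m`). -/
def rightBorders (s : State) (m q : ℕ) : List ℕ := (List.Ico m q).map s.b

/-- `b_{p+1}++; …; b_{m-1}++`. -/
def incBorders (s : State) (m p : ℕ) : State :=
  { s with b := fun t => if p + 1 ≤ t ∧ t < m then s.b t + 1 else s.b t }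

/-- `b_m--; …; b_{q-1}--`. -/
def decBorders (s : State) (m q : ℕ) : State :=
  { s with b := fun t => if m ≤ t ∧ t < q then s.b t - 1 else s.b t }

/-- `i++`. -/
def incI (s : State) : State := { s with i := s.i + 1 }

/-- `j--`. -/
def decJ (s : State) : State := { s with j := s.j - 1 }

end State

/-- The body of the first inner loop, executed when `A[i]` belongs to group `A_p`, `p < m`. -/
def bodyI (m : ℕ) (s : State) : State :=
  let p := s.A s.i
  (if p + 1 < m then (s.rot (s.i :: s.leftBorders m p)).incBorders m p else s).incI

/-- The body of the second inner loop, executed when `A[j]` belongs to group `A_q`, `q ≥ m`. -/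
def bodyJ (m : ℕ) (s : State) : State :=
  let q := s.A s.j
  (if m + 1 ≤ q then (s.rot (s.j :: s.rightBorders m q)).decBorders m q else s).decJ

/-- The exchange step: with `A[i]` in group `A_p` and `A[j]` in group `A_q`,
`rotate(i, b_{m-1}, …, b_{q+1}, j, b_m, …, b_{p-1})`, followed by the pointer updates. -/
def exchangeStep (m : ℕ) (s : State) : State :=
  let p := s.A s.i
  let q := s.A s.j
  (((s.rot (s.i :: s.leftBorders m q ++ s.j :: s.rightBorders m p)).incI.incBorders m q).decJ).decBorders
    m p

theorem bodyI_i (m : ℕ) (s : State) : (bodyI m s).i = s.i + 1 := by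
  simp only [bodyI, State.incI]; split <;> rfl

theorem bodyI_j (m : ℕ) (s : State) : (bodyI m s).j = s.j := by
  simp only [bodyI, State.incI]; split <;> rfl

theorem bodyJ_i (m : ℕ) (s : State) : (bodyJ m s).i = s.i := by
  simp only [bodyJ, State.decJ]; split <;> rfl

theorem bodyJ_j (m : ℕ) (s : State) : (bodyJ m s).j = s.j - 1 := by
  simp only [bodyJ, State.decJ]; split <;> rfl

/-- First inner loop: while `A[i]` belongs to a group `A_p` with `p < m`.
The loop also ends when `i` leaves the array, since there is no element in `A[n+1]`. -/
def loopI (m n : ℕ) (s : State) : State :=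
  if s.i ≤ n ∧ s.A s.i < m then loopI m n (bodyI m s) else s
termination_by n + 1 - s.i
decreasing_by rw [bodyI_i]; omega

/-- Second inner loop: while `A[j]` belongs to a group `A_q` with `q ≥ m`.
The loop also ends when `j` reaches the cell `A[k]`, since that cell holds a pivot, which does not
belong to any group. -/
def loopJ (k m : ℕ) (s : State) : State :=
  if k < s.j ∧ m ≤ s.A s.j then loopJ k m (bodyJ m s) else s
termination_by s.j
decreasing_by rw [bodyJ_j]; omega

theorem loopI_pointers (m n : ℕ) (s : State) :
    s.i ≤ (loopI m n s).i ∧ (loopI m n s).j = s.j := by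
  induction s using loopI.induct m n with
  | case1 s h ih =>
    rw [loopI, if_pos h]
    rw [bodyI_i, bodyI_j] at ih
    exact ⟨by omega, ih.2⟩
  | case2 s h => rw [loopI, if_neg h]; exact ⟨le_rfl, rfl⟩

theorem loopJ_pointers (k m : ℕ) (s : State) :
    (loopJ k m s).i = s.i ∧ (loopJ k m s).j ≤ s.j := by
  induction s using loopJ.induct k m with
  | case1 s h ih =>
    rw [loopJ, if_pos h]
    rw [bodyJ_i, bodyJ_j] at ih
    exact ⟨ih.1, by omega⟩
  | case2 s h => rw [loopJ, if_neg h]; exact ⟨rfl, le_rfl⟩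

/-- The body of the outer loop: the two inner loops, and an exchange step if then `i < j`. -/
def outerBody (k m n : ℕ) (s : State) : State :=
  let s' := loopJ k m (loopI m n s)
  if s'.i < s'.j then exchangeStep m s' else s'

theorem outerBody_lt (k m n : ℕ) (s : State) (h : s.i < s.j) :
    (outerBody k m n s).j - (outerBody k m n s).i < s.j - s.i := by
  have h1 := loopI_pointers m n s
  have h2 := loopJ_pointers k m (loopI m n s)
  simp only [outerBody]
  split
  · change (loopJ k m (loopI m n s)).j - 1 - ((loopJ k m (loopI m n s)).i + 1) < s.j - s.i
    omega
  · omega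

/-- The outer loop: while `i < j`. -/
def outerLoop (k m n : ℕ) (s : State) : State :=
  if s.i < s.j then outerLoop k m n (outerBody k m n s) else s
termination_by s.j - s.i
decreasing_by rename_i h; exact outerBody_lt k m n s h

/-- `m = ⌈(k + 1) / 2⌉`, the number of groups that are gathered at the left of pointer `i`. -/
def numLeft (k : ℕ) : ℕ := (k + 1) ⌈/⌉ 2

/-- The initialization: `i, b_1, …, b_{m-1}` are set to `k + 1` and `j, b_m, …, b_{k-1}` to `n`. -/
def initState (k n : ℕ) (A : ℕ → ℕ) : State where
  A := A
  i := k + 1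
  j := n
  b := fun t => if t < numLeft k then k + 1 else n
  writes := 0
  assigns := 0

/-- The final state of `Exchange_k` on the array `A[1..n]`, whose first `k` cells hold the pivots. -/
def exchange (k n : ℕ) (A : ℕ → ℕ) : State :=
  outerLoop k (numLeft k) n (initState k n A)

/-- The input array for the permutation `(e_1, …, e_n)` given by `e_s = σ (s - 1)`. The pivots
are `e_1, …, e_k`; in sorted order `p_1 < ⋯ < p_k`, the element `x` belongs to group `A_h` if
`p_h < x < p_{h+1}`, i.e. if exactly `h` of the pivots are smaller than `x`. Only the entries of the
cells `k + 1, …, n` are relevant. -/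
def inputArray (k n : ℕ) (σ : Equiv.Perm (Fin n)) (s : ℕ) : ℕ :=
  if h : s - 1 < n then
    (Finset.univ.filter fun r : Fin n => r.val < k ∧ σ r < σ ⟨s - 1, h⟩).card
  else 0

/-- The number of cells inspected by a pointer with initial value `ls` and final value `le`. -/
def pointerCost (ls le : ℕ) : ℕ := ((ls : ℤ) - (le : ℤ)).natAbs

/-- The number of scanned elements: total cost of the pointers `i, j, b_1, …, b_{k-1}`. -/
def scanned (k n : ℕ) (σ : Equiv.Perm (Fin n)) : ℕ :=
  let s₀ := initState k n (inputArray k n σ)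
  let s₁ := exchange k n (inputArray k n σ)
  pointerCost s₀.i s₁.i + pointerCost s₀.j s₁.j +
    ∑ t ∈ Finset.Icc 1 (k - 1), pointerCost (s₀.b t) (s₁.b t)

/-- The number of write accesses to array cells over all `rotate` operations. -/
def writeAccesses (k n : ℕ) (σ : Equiv.Perm (Fin n)) : ℕ :=
  (exchange k n (inputArray k n σ)).writes

/-- The number of assignments over all `rotate` operations. -/
def assignments (k n : ℕ) (σ : Equiv.Perm (Fin n)) : ℕ :=
  (exchange k n (inputArray k n σ)).assigns

/-- The expected value of a cost for a uniformly random permutation of `n` elements. -/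
noncomputable def expectedCost (n : ℕ) (X : Equiv.Perm (Fin n) → ℕ) : ℝ :=
  (∑ σ : Equiv.Perm (Fin n), (X σ : ℝ)) / (n.factorial : ℝ)

end MultiPivot

/-! ### Effect of a rotation, and costs as sums over processed cells -/

namespace MultiPivot

/-! Every processed element contributes an amount that depends only on its group and on whether `i`
or `j` read it. This is clear for the inner loops. In an exchange with groups `p ≥ m > q` the
rotation has `(p - m + 1) + (m - q)` indices, which splits into a share for each element; the
additional assignment is charged to the element read by `j`. The invariant `Inv` records this,
together with the facts that cells between the pointers are untouched and that `i` has advanced by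
the number of processed elements in groups below `m`.

At termination at most one cell is unprocessed. Hence, up to a bounded error, the first `L`
non-pivot cells are read by `i` and the others by `j`, where `L` is the total number of elements in
groups below `m` (`Inv.splitSum_bounds`). The algorithm has now disappeared, and only the law of the
groups remains.

Permuting the non-pivot positions preserves the uniform distribution and `L`. So, among `N = n - k`
cells, an element is read by `i` with conditional frequency `L / N`, which is the frequency with
which a second element `y` lies in a group below `m`. Therefore `N` times the expected cost is a sum
over pairs `(x, y)` (`card_mul_sum_permCost`). For `x ≠ y` the ranks of `x, y` among themselves and
the pivots form a uniform pair of distinct numbers below `k + 2`; hence groups `(g, h)` have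
probability `(1 + [g = h]) / ((k + 1) (k + 2))` (`sum_perm_group_pair`). Diagonal pairs contribute
only a bounded amount to the expected cost, so the linear coefficient is `rate`, which reduces to
triangular sums. -/

theorem rotateAux_of_notMem (tmp c : ℕ) : ∀ (l : List ℕ) (A : ℕ → ℕ), c ∉ l →
    rotateAux tmp A l c = A c
  | [], A, _ => rfl
  | [x], A, h => by
    simp only [List.mem_singleton] at h
    simp [rotateAux, Function.update_of_ne h]
  | x :: y :: l, A, h => by
    rw [rotateAux, rotateAux_of_notMem tmp c (y :: l) _ fun h' => h (List.mem_cons_of_mem _ h')]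
    exact Function.update_of_ne (fun h' => h (by simp [h'])) _ _

/-- A rotation moves the hole `x` through `S` and finally fills it with `tmp`. -/
theorem rotateAux_fill {P : ℕ → Prop} {S : Set ℕ} {tmp : ℕ} (hP : P tmp) :
    ∀ (l : List ℕ) (x : ℕ) (A : ℕ → ℕ), (∀ c ∈ S, c ≠ x → P (A c)) → (∀ y ∈ x :: l, y ∈ S) →
      ∀ c ∈ S, P (rotateAux tmp A (x :: l) c)
  | [], x, A, h, _, c, hc => by
    by_cases hx : c = x
    · subst hx; simpa [rotateAux] using hP
    · simpa [rotateAux, Function.update_of_ne hx] using h c hc hx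
  | y :: l, x, A, h, hl, c, hc => by
    rw [rotateAux]
    -- After `A[x] ← A[y]` the hole is `y`. Indices need not be distinct, which matters since border
    -- pointers may coincide.
    refine rotateAux_fill hP l y _ (fun d hd hdy => ?_)
      (fun z hz => hl z (List.mem_cons_of_mem _ hz)) c hc
    by_cases hx : d = x
    · subst hx
      rw [Function.update_self]
      exact h y (hl y (by simp)) (Ne.symm hdy)
    · rw [Function.update_of_ne hx]
      exact h d hd hx

/-- The first part does not touch cell `z`, so it ends by receiving the original `A z`. With `z = j`
this separates an exchange into a rotation on the left filled with `A[j]` and one on the right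
filled with `A[i]`. -/
theorem rotateAux_append (tmp z : ℕ) (l' : List ℕ) : ∀ (l : List ℕ) (x : ℕ) (A : ℕ → ℕ),
    z ∉ x :: l → rotateAux tmp A (x :: l ++ z :: l') =
      rotateAux tmp (rotateAux (A z) A (x :: l)) (z :: l')
  | [], x, A, _ => rfl
  | y :: l, x, A, h => by
    have := rotateAux_append tmp z l' l y (Function.update A x (A y))
      fun h' => h (List.mem_cons_of_mem _ h')
    rw [Function.update_of_ne (fun h' => h (by simp [h']))] at this
    simpa [rotateAux] using this

/-- The sum of `fl` over the groups of the cells `k + 1, …, i - 1` and of `fr` over the groups of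
the cells `j + 1, …, n`. -/
def splitSum (k n : ℕ) (A₀ : ℕ → ℕ) (fl fr : ℕ → ℕ) (i j : ℕ) : ℕ :=
  ∑ c ∈ Finset.Ico (k + 1) i, fl (A₀ c) + ∑ c ∈ Finset.Ioc j n, fr (A₀ c)

section SplitSum

variable {k n : ℕ} {A₀ fl fr : ℕ → ℕ} {i j : ℕ}

theorem splitSum_succ_left (h : k + 1 ≤ i) :
    splitSum k n A₀ fl fr (i + 1) j = splitSum k n A₀ fl fr i j + fl (A₀ i) := by
  rw [splitSum, Finset.sum_Ico_succ_top h, splitSum]; ring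

theorem splitSum_pred_right (h : 1 ≤ j) (hn : j ≤ n) :
    splitSum k n A₀ fl fr i (j - 1) = splitSum k n A₀ fl fr i j + fr (A₀ j) := by
  have : Finset.Ioc (j - 1) n = insert j (Finset.Ioc j n) := by
    ext c; simp only [Finset.mem_Ioc, Finset.mem_insert]; omega
  rw [splitSum, this, Finset.sum_insert (by simp), splitSum]; ring

theorem splitSum_init : splitSum k n A₀ fl fr (k + 1) n = 0 := by simp [splitSum]

end SplitSum

/-- Write accesses caused by an element of group `g` that is read by pointer `i`. -/
def writesLeft (m g : ℕ) : ℕ := if g + 1 < m then m - g else if g < m then 0 else g - m + 1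

/-- Write accesses caused by an element of group `g` that is read by pointer `j`. -/
def writesRight (m g : ℕ) : ℕ := if m + 1 ≤ g then g - m + 1 else if m ≤ g then 0 else m - g

/-- Assignments caused by an element of group `g` that is read by pointer `i`. -/
def assignsLeft (m g : ℕ) : ℕ := if g + 1 < m then m - g + 1 else if g < m then 0 else g - m + 1

/-- Assignments caused by an element of group `g` that is read by pointer `j`. -/
def assignsRight (m g : ℕ) : ℕ :=
  if m + 1 ≤ g then g - m + 2 else if m ≤ g then 0 else m - g + 1

/-- The number of pointers that scan an element of group `g`. -/
def scans (m g : ℕ) : ℕ := if g < m then m - g else g - m + 1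

/-- The loop invariant of `Exchange_k` on the input array `A₀`. -/
structure Inv (k m n : ℕ) (A₀ : ℕ → ℕ) (s : State) : Prop where
  le_i : k + 1 ≤ s.i
  j_le : s.j ≤ n
  i_le : s.i ≤ s.j + 1
  mid : ∀ c, s.i ≤ c → c ≤ s.j → s.A c = A₀ c
  left : ∀ c, k + 1 ≤ c → c < s.i → s.A c < m
  right : ∀ c, s.j < c → c ≤ n → m ≤ s.A c
  border_left : ∀ t, t < m → k + 1 ≤ s.b t ∧ s.b t ≤ s.i
  border_right : ∀ t, m ≤ t → s.j ≤ s.b t ∧ s.b t ≤ n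
  count_left : ∀ t, t < m → s.b t = k + 1 +
    splitSum k n A₀ (fun g => if g < t then 1 else 0) (fun g => if g < t then 1 else 0) s.i s.j
  count_right : ∀ t, m ≤ t → s.b t +
    splitSum k n A₀ (fun g => if t < g then 1 else 0) (fun g => if t < g then 1 else 0) s.i s.j = n
  balance : s.i = k + 1 +
    splitSum k n A₀ (fun g => if g < m then 1 else 0) (fun g => if g < m then 1 else 0) s.i s.j
  writes : s.writes = splitSum k n A₀ (writesLeft m) (writesRight m) s.i s.j
  assigns : s.assigns = splitSum k n A₀ (assignsLeft m) (assignsRight m) s.i s.j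

theorem State.mem_leftBorders {s : State} {m p y : ℕ} (h : y ∈ s.leftBorders m p) :
    ∃ t, t < m ∧ s.b t = y := by
  simp only [State.leftBorders, List.mem_map, List.mem_reverse, List.Ico.mem] at h
  obtain ⟨t, ht, rfl⟩ := h
  exact ⟨t, ht.2, rfl⟩

theorem State.mem_rightBorders {s : State} {m q y : ℕ} (h : y ∈ s.rightBorders m q) :
    ∃ t, m ≤ t ∧ s.b t = y := by
  simp only [State.rightBorders, List.mem_map, List.Ico.mem] at h
  obtain ⟨t, ht, rfl⟩ := h
  exact ⟨t, ht.1, rfl⟩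

theorem State.length_leftBorders (s : State) (m p : ℕ) :
    (s.leftBorders m p).length = m - (p + 1) := by simp [State.leftBorders]

theorem State.length_rightBorders (s : State) (m q : ℕ) :
    (s.rightBorders m q).length = q - m := by simp [State.rightBorders]

/-! ### Preservation of the loop invariant -/

section Invariant

variable {k m n : ℕ} {A₀ : ℕ → ℕ} {s : State}

theorem Inv.init (h : k + 1 ≤ n) : Inv k (numLeft k) n A₀ (initState k n A₀) where
  le_i := le_rfl
  j_le := le_rfl
  i_le := by simp only [initState]; omega
  mid _ _ _ := rfl
  left c h₁ h₂ := by simp only [initState] at h₂; omega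
  right c h₁ h₂ := by simp only [initState] at h₁; omega
  border_left t ht := by simp [initState, ht]
  border_right t ht := by simp [initState, Nat.not_lt.mpr ht]
  count_left t ht := by simp [initState, ht, splitSum_init]
  count_right t ht := by simp [initState, Nat.not_lt.mpr ht, splitSum_init]
  balance := by simp [initState, splitSum_init]
  writes := by simp [initState, splitSum_init]
  assigns := by simp [initState, splitSum_init]

/-- The fields of the state after one execution of the body of the first inner loop. -/
theorem bodyI_spec (m : ℕ) (s : State) :
    (bodyI m s).A = (if s.A s.i + 1 < m then rotate s.A (s.i :: s.leftBorders m (s.A s.i))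
      else s.A) ∧
    (bodyI m s).b = (fun t => if s.A s.i + 1 ≤ t ∧ t < m then s.b t + 1 else s.b t) ∧
    (bodyI m s).writes = s.writes + (if s.A s.i + 1 < m then m - s.A s.i else 0) ∧
    (bodyI m s).assigns = s.assigns + (if s.A s.i + 1 < m then m - s.A s.i + 1 else 0) := by
  unfold bodyI
  by_cases h : s.A s.i + 1 < m
  · simp only [h, if_true, State.incI, State.incBorders, State.rot, List.length_cons,
      State.length_leftBorders, true_and]
    omega
  · simp only [h, if_false, State.incI, true_and, add_zero, and_true]
    funext t
    rw [if_neg (by omega)]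

theorem bodyJ_spec (m : ℕ) (s : State) :
    (bodyJ m s).A = (if m + 1 ≤ s.A s.j then rotate s.A (s.j :: s.rightBorders m (s.A s.j))
      else s.A) ∧
    (bodyJ m s).b = (fun t => if m ≤ t ∧ t < s.A s.j then s.b t - 1 else s.b t) ∧
    (bodyJ m s).writes = s.writes + (if m + 1 ≤ s.A s.j then s.A s.j - m + 1 else 0) ∧
    (bodyJ m s).assigns = s.assigns + (if m + 1 ≤ s.A s.j then s.A s.j - m + 2 else 0) := by
  unfold bodyJ
  by_cases h : m + 1 ≤ s.A s.j
  · simp only [h, if_true, State.decJ, State.decBorders, State.rot, List.length_cons,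
      State.length_rightBorders, true_and]
  · simp only [h, if_false, State.decJ, true_and, add_zero, and_true]
    funext t
    rw [if_neg (by omega)]

theorem Inv.bodyI (hs : Inv k m n A₀ s) (hin : s.i ≤ n) (hA : s.A s.i < m) :
    Inv k m n A₀ (bodyI m s) := by
  -- Cells beyond `j` hold groups at least `m`, so the loop condition excludes `i = j + 1`.
  have hij : s.i ≤ s.j := by
    by_contra h
    exact absurd (hs.right s.i (by omega) hin) (by omega)
  have hA₀ : s.A s.i = A₀ s.i := hs.mid _ le_rfl hij
  obtain ⟨eA, eb, ew, ea⟩ := bodyI_spec m s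
  have hle := hs.le_i
  -- All rotated cells lie in `[k + 1, i]`. The order of the groups inside this zone is irrelevant
  -- to the cost; only the bound `m` must survive.
  have key : (∀ c ∈ Set.Icc (k + 1) s.i, (MultiPivot.bodyI m s).A c < m) ∧
      ∀ c, s.i < c → (MultiPivot.bodyI m s).A c = s.A c := by
    rw [eA]
    split_ifs with h
    · have hmem : ∀ y ∈ s.i :: s.leftBorders m (s.A s.i), y ∈ Set.Icc (k + 1) s.i := by
        intro y hy
        rcases List.mem_cons.mp hy with rfl | hy
        · exact ⟨hle, le_rfl⟩
        · obtain ⟨t, ht, rfl⟩ := State.mem_leftBorders hy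
          exact hs.border_left t ht
      refine ⟨rotateAux_fill (P := (· < m)) hA _ _ _ (fun c hc hci => ?_) hmem, fun c hc => ?_⟩
      · exact hs.left c hc.1 (lt_of_le_of_ne hc.2 hci)
      · exact rotateAux_of_notMem _ _ _ _ fun h' => absurd (hmem c h').2 (by omega)
    · refine ⟨fun c hc => ?_, fun _ _ => rfl⟩
      rcases eq_or_lt_of_le hc.2 with rfl | h'
      · exact hA
      · exact hs.left c hc.1 h'
  constructor
  · rw [bodyI_i]; omega
  · rw [bodyI_j]; exact hs.j_le
  · rw [bodyI_i, bodyI_j]; omega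
  · rw [bodyI_i, bodyI_j]; intro c h₁ h₂
    rw [key.2 c (by omega)]; exact hs.mid c (by omega) h₂
  · rw [bodyI_i]; intro c h₁ h₂
    exact key.1 c ⟨h₁, by omega⟩
  · rw [bodyI_j]; intro c h₁ h₂
    rw [key.2 c (by omega)]; exact hs.right c h₁ h₂
  · rw [bodyI_i, eb]; intro t ht
    have := hs.border_left t ht
    dsimp only; split_ifs <;> omega
  · rw [bodyI_j, eb]; intro t ht
    have := hs.border_right t ht
    dsimp only; split_ifs <;> omega
  · rw [bodyI_i, bodyI_j, eb]; intro t ht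
    have := hs.count_left t ht
    rw [splitSum_succ_left hle, ← hA₀]
    dsimp only; split_ifs <;> omega
  · rw [bodyI_i, bodyI_j, eb]; intro t ht
    have := hs.count_right t ht
    rw [splitSum_succ_left hle, ← hA₀]
    dsimp only; split_ifs <;> omega
  · rw [bodyI_i, bodyI_j]
    have := hs.balance
    rw [splitSum_succ_left hle, ← hA₀, if_pos hA]
    omega
  · rw [bodyI_i, bodyI_j, splitSum_succ_left hle, ← hA₀, ew, hs.writes, writesLeft, if_pos hA]
  · rw [bodyI_i, bodyI_j, splitSum_succ_left hle, ← hA₀, ea, hs.assigns, assignsLeft, if_pos hA]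

theorem Inv.bodyJ (hs : Inv k m n A₀ s) (hkj : k < s.j) (hA : m ≤ s.A s.j) :
    Inv k m n A₀ (bodyJ m s) := by
  have hij : s.i ≤ s.j := by
    by_contra h
    exact absurd (hs.left s.j (by omega) (by omega)) (by omega)
  have hA₀ : s.A s.j = A₀ s.j := hs.mid _ hij le_rfl
  obtain ⟨eA, eb, ew, ea⟩ := bodyJ_spec m s
  have hle := hs.j_le
  have h1 : 1 ≤ s.j := by omega
  have key : (∀ c ∈ Set.Icc s.j n, m ≤ (MultiPivot.bodyJ m s).A c) ∧
      ∀ c, c < s.j → (MultiPivot.bodyJ m s).A c = s.A c := by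
    rw [eA]
    split_ifs with h
    · have hmem : ∀ y ∈ s.j :: s.rightBorders m (s.A s.j), y ∈ Set.Icc s.j n := by
        intro y hy
        rcases List.mem_cons.mp hy with rfl | hy
        · exact ⟨le_rfl, hle⟩
        · obtain ⟨t, ht, rfl⟩ := State.mem_rightBorders hy
          exact hs.border_right t ht
      refine ⟨rotateAux_fill (P := (m ≤ ·)) hA _ _ _ (fun c hc hci => ?_) hmem, fun c hc => ?_⟩
      · exact hs.right c (lt_of_le_of_ne hc.1 (Ne.symm hci)) hc.2
      · exact rotateAux_of_notMem _ _ _ _ fun h' => absurd (hmem c h').1 (by omega)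
    · refine ⟨fun c hc => ?_, fun _ _ => rfl⟩
      rcases eq_or_lt_of_le hc.1 with rfl | h'
      · exact hA
      · exact hs.right c h' hc.2
  constructor
  · rw [bodyJ_i]; exact hs.le_i
  · rw [bodyJ_j]; omega
  · rw [bodyJ_i, bodyJ_j]; omega
  · rw [bodyJ_i, bodyJ_j]; intro c h₁ h₂
    rw [key.2 c (by omega)]; exact hs.mid c h₁ (by omega)
  · rw [bodyJ_i]; intro c h₁ h₂
    rw [key.2 c (by omega)]; exact hs.left c h₁ h₂
  · rw [bodyJ_j]; intro c h₁ h₂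
    exact key.1 c ⟨by omega, h₂⟩
  · rw [bodyJ_i, eb]; intro t ht
    have := hs.border_left t ht
    dsimp only; split_ifs <;> omega
  · rw [bodyJ_j, eb]; intro t ht
    have := hs.border_right t ht
    dsimp only; split_ifs <;> omega
  · rw [bodyJ_i, bodyJ_j, eb]; intro t ht
    have := hs.count_left t ht
    rw [splitSum_pred_right h1 hle, ← hA₀]
    dsimp only; split_ifs <;> omega
  · rw [bodyJ_i, bodyJ_j, eb]; intro t ht
    have := hs.count_right t ht
    -- Gives `b t ≥ j ≥ 1`, so the truncated decrement is a true one.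
    have := hs.border_right t ht
    rw [splitSum_pred_right h1 hle, ← hA₀]
    dsimp only; split_ifs <;> omega
  · rw [bodyJ_i, bodyJ_j]
    have := hs.balance
    rw [splitSum_pred_right h1 hle, ← hA₀, if_neg (by omega)]
    omega
  · rw [bodyJ_i, bodyJ_j, splitSum_pred_right h1 hle, ← hA₀, ew, hs.writes, writesRight, if_pos hA]
  · rw [bodyJ_i, bodyJ_j, splitSum_pred_right h1 hle, ← hA₀, ea, hs.assigns, assignsRight,
      if_pos hA]

theorem exchangeStep_b (m : ℕ) (s : State) (t : ℕ) : (exchangeStep m s).b t =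
    if m ≤ t ∧ t < s.A s.i then (if s.A s.j + 1 ≤ t ∧ t < m then s.b t + 1 else s.b t) - 1
    else (if s.A s.j + 1 ≤ t ∧ t < m then s.b t + 1 else s.b t) := rfl

theorem exchangeStep_A (m : ℕ) (s : State) : (exchangeStep m s).A =
    rotateAux (s.A s.i) s.A
      (s.i :: s.leftBorders m (s.A s.j) ++ s.j :: s.rightBorders m (s.A s.i)) := rfl

theorem Inv.exchangeStep (hs : Inv k m n A₀ s) (hij : s.i < s.j) (hi : m ≤ s.A s.i)
    (hj : s.A s.j < m) : Inv k m n A₀ (exchangeStep m s) := by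
  have hi₀ : s.A s.i = A₀ s.i := hs.mid _ le_rfl hij.le
  have hj₀ : s.A s.j = A₀ s.j := hs.mid _ hij.le le_rfl
  have hle := hs.le_i
  have hjn := hs.j_le
  have h1 : 1 ≤ s.j := by omega
  have ei : (MultiPivot.exchangeStep m s).i = s.i + 1 := rfl
  have ej : (MultiPivot.exchangeStep m s).j = s.j - 1 := rfl
  have hlen : (s.i :: s.leftBorders m (s.A s.j) ++ s.j :: s.rightBorders m (s.A s.i)).length =
      (s.A s.i - m + 1) + (m - s.A s.j) := by
    rw [List.length_append, List.length_cons, List.length_cons, State.length_leftBorders,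
      State.length_rightBorders]
    omega
  have ew : (MultiPivot.exchangeStep m s).writes =
      s.writes + ((s.A s.i - m + 1) + (m - s.A s.j)) := by
    rw [← hlen]; rfl
  -- The additional assignment of the rotation goes to the share of the element at `j`, as in
  -- `assignsRight`.
  have ea : (MultiPivot.exchangeStep m s).assigns =
      s.assigns + ((s.A s.i - m + 1) + (m - s.A s.j + 1)) := by
    rw [← add_assoc (s.A s.i - m + 1), ← hlen]; rfl
  have hl : ∀ y ∈ s.i :: s.leftBorders m (s.A s.j), y ∈ Set.Icc (k + 1) s.i := by
    intro y hy
    rcases List.mem_cons.mp hy with rfl | hy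
    · exact ⟨hle, le_rfl⟩
    · obtain ⟨t, ht, rfl⟩ := State.mem_leftBorders hy
      exact hs.border_left t ht
  have hr : ∀ y ∈ s.j :: s.rightBorders m (s.A s.i), y ∈ Set.Icc s.j n := by
    intro y hy
    rcases List.mem_cons.mp hy with rfl | hy
    · exact ⟨le_rfl, hjn⟩
    · obtain ⟨t, ht, rfl⟩ := State.mem_rightBorders hy
      exact hs.border_right t ht
  have hnl : ∀ c, s.i < c → c ∉ s.i :: s.leftBorders m (s.A s.j) :=
    fun c hc h => absurd (hl c h).2 (by omega)
  have hnr : ∀ c, c < s.j → c ∉ s.j :: s.rightBorders m (s.A s.i) :=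
    fun c hc h => absurd (hr c h).1 (by omega)
  have keyl : ∀ c ∈ Set.Icc (k + 1) s.i, (MultiPivot.exchangeStep m s).A c < m := by
    intro c hc
    rw [exchangeStep_A, rotateAux_append _ _ _ _ _ _ (hnl _ hij),
      rotateAux_of_notMem _ _ _ _ (hnr c (lt_of_le_of_lt hc.2 hij))]
    exact rotateAux_fill (P := (· < m)) hj _ _ _
      (fun c hc hci => hs.left c hc.1 (lt_of_le_of_ne hc.2 hci)) hl c hc
  have keyr : ∀ c ∈ Set.Icc s.j n, m ≤ (MultiPivot.exchangeStep m s).A c := by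
    intro c hc
    rw [exchangeStep_A, rotateAux_append _ _ _ _ _ _ (hnl _ hij)]
    refine rotateAux_fill (P := (m ≤ ·)) hi _ _ _ (fun c hc hci => ?_) hr c hc
    have hlt : s.j < c := lt_of_le_of_ne hc.1 (Ne.symm hci)
    rw [rotateAux_of_notMem _ _ _ _ (hnl c (hij.trans hlt))]
    exact hs.right c hlt hc.2
  have keym : ∀ c, s.i < c → c < s.j → (MultiPivot.exchangeStep m s).A c = s.A c := by
    intro c h₁ h₂
    rw [exchangeStep_A, rotateAux_append _ _ _ _ _ _ (hnl _ hij),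
      rotateAux_of_notMem _ _ _ _ (hnr c h₂), rotateAux_of_notMem _ _ _ _ (hnl c h₁)]
  have hsum : ∀ fl fr : ℕ → ℕ, splitSum k n A₀ fl fr (s.i + 1) (s.j - 1) =
      splitSum k n A₀ fl fr s.i s.j + fr (s.A s.j) + fl (s.A s.i) := by
    intro fl fr
    rw [splitSum_succ_left hle, splitSum_pred_right h1 hjn, hi₀, hj₀]
  constructor
  · rw [ei]; omega
  · rw [ej]; omega
  · rw [ei, ej]; omega
  · rw [ei, ej]; intro c h₁ h₂
    rw [keym c (by omega) (by omega)]; exact hs.mid c (by omega) (by omega)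
  · rw [ei]; intro c h₁ h₂
    exact keyl c ⟨h₁, by omega⟩
  · rw [ej]; intro c h₁ h₂
    exact keyr c ⟨by omega, h₂⟩
  · rw [ei]; intro t ht
    have := hs.border_left t ht
    rw [exchangeStep_b]; split_ifs <;> omega
  · rw [ej]; intro t ht
    have := hs.border_right t ht
    rw [exchangeStep_b]; split_ifs <;> omega
  · rw [ei, ej]; intro t ht
    have := hs.count_left t ht
    rw [hsum, exchangeStep_b]; split_ifs <;> omega
  · rw [ei, ej]; intro t ht
    have := hs.count_right t ht
    have := hs.border_right t ht
    rw [hsum, exchangeStep_b]; split_ifs <;> omega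
  · rw [ei, ej]
    have := hs.balance
    rw [hsum, if_pos hj, if_neg (by omega)]
    omega
  · rw [ei, ej, hsum, ew, hs.writes, writesLeft, writesRight]; split_ifs <;> omega
  · rw [ei, ej, hsum, ea, hs.assigns, assignsLeft, assignsRight]; split_ifs <;> omega

theorem Inv.loopI (hs : Inv k m n A₀ s) : Inv k m n A₀ (loopI m n s) ∧
    ¬((MultiPivot.loopI m n s).i ≤ n ∧
      (MultiPivot.loopI m n s).A (MultiPivot.loopI m n s).i < m) := by
  induction s using loopI.induct m n with
  | case1 s h ih => rw [MultiPivot.loopI, if_pos h]; exact ih (hs.bodyI h.1 h.2)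
  | case2 s h => rw [MultiPivot.loopI, if_neg h]; exact ⟨hs, h⟩

theorem Inv.loopJ (hs : Inv k m n A₀ s) : Inv k m n A₀ (loopJ k m s) ∧
    ¬(k < (MultiPivot.loopJ k m s).j ∧
      m ≤ (MultiPivot.loopJ k m s).A (MultiPivot.loopJ k m s).j) := by
  induction s using loopJ.induct k m with
  | case1 s h ih => rw [MultiPivot.loopJ, if_pos h]; exact ih (hs.bodyJ h.1 h.2)
  | case2 s h => rw [MultiPivot.loopJ, if_neg h]; exact ⟨hs, h⟩

theorem Inv.outerBody (hs : Inv k m n A₀ s) : Inv k m n A₀ (outerBody k m n s) := by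
  obtain ⟨h₁, h₁'⟩ := hs.loopI
  obtain ⟨h₂, h₂'⟩ := h₁.loopJ
  have hp := loopJ_pointers k m (MultiPivot.loopI m n s)
  have hle := h₂.le_i
  have hjn := h₂.j_le
  simp only [MultiPivot.outerBody]
  split_ifs with h
  · refine h₂.exchangeStep h ?_ ?_
    -- The second inner loop may have changed the array, but cell `i` is still unprocessed, so its
    -- content before and after that loop is the input value.
    · rw [h₂.mid _ le_rfl h.le]
      rw [hp.1] at h ⊢
      rw [← h₁.mid _ le_rfl (by omega)]
      by_contra hc
      exact h₁' ⟨by omega, by omega⟩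
    · by_contra hc
      exact h₂' ⟨by omega, by omega⟩
  · exact h₂

theorem Inv.outerLoop (hs : Inv k m n A₀ s) :
    Inv k m n A₀ (outerLoop k m n s) ∧ (outerLoop k m n s).j ≤ (outerLoop k m n s).i := by
  induction s using MultiPivot.outerLoop.induct k m n with
  | case1 s h ih => rw [MultiPivot.outerLoop, if_pos h]; exact ih hs.outerBody
  | case2 s h => rw [MultiPivot.outerLoop, if_neg h]; exact ⟨hs, by omega⟩

end Invariant

/-! ### Comparison with a cost that does not refer to the algorithm -/

/-- The number of cells among `k + 1, …, n` whose group is less than `m`. -/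
def numSmall (k m n : ℕ) (A₀ : ℕ → ℕ) : ℕ :=
  ∑ c ∈ Finset.Icc (k + 1) n, if A₀ c < m then 1 else 0

/-- The cost of an array if every element of a group less than `m` cost the value of `fl` at its
final position, that is, if the cells up to `k + numSmall` are read by pointer `i`. -/
def idealCost (k m n : ℕ) (fl fr A₀ : ℕ → ℕ) : ℕ :=
  ∑ c ∈ Finset.Icc (k + 1) n, if c ≤ k + numSmall k m n A₀ then fl (A₀ c) else fr (A₀ c)

theorem splitSum_add_rest {k n : ℕ} {A₀ : ℕ → ℕ} (fl fr : ℕ → ℕ) {i j : ℕ} (hi : k + 1 ≤ i)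
    (hj : j ≤ n) (hij : i ≤ j + 1) (F : ℕ → ℕ) (hl : ∀ c, k + 1 ≤ c → c < i → F c = fl (A₀ c))
    (hr : ∀ c, j < c → c ≤ n → F c = fr (A₀ c)) :
    ∑ c ∈ Finset.Icc (k + 1) n, F c = splitSum k n A₀ fl fr i j + ∑ c ∈ Finset.Icc i j, F c := by
  have hu : Finset.Icc (k + 1) n = (Finset.Ico (k + 1) i ∪ Finset.Ioc j n) ∪ Finset.Icc i j := by
    ext c; simp only [Finset.mem_Icc, Finset.mem_union, Finset.mem_Ico, Finset.mem_Ioc]; omega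
  rw [hu, Finset.sum_union, Finset.sum_union, splitSum]
  · congr 2
    · exact Finset.sum_congr rfl fun c hc => by
        rw [Finset.mem_Ico] at hc; exact hl c hc.1 hc.2
    · exact Finset.sum_congr rfl fun c hc => by
        rw [Finset.mem_Ioc] at hc; exact hr c hc.1 hc.2
  · exact Finset.disjoint_left.mpr fun c h₁ h₂ => by
      simp only [Finset.mem_Ico, Finset.mem_Ioc] at h₁ h₂; omega
  · exact Finset.disjoint_left.mpr fun c h₁ h₂ => by
      simp only [Finset.mem_Ico, Finset.mem_Ioc, Finset.mem_union, Finset.mem_Icc] at h₁ h₂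
      omega

theorem sum_Icc_le_of_le_succ {i j B : ℕ} (h : j ≤ i) (F : ℕ → ℕ)
    (hF : ∀ c ∈ Finset.Icc i j, F c ≤ B) : ∑ c ∈ Finset.Icc i j, F c ≤ B := by
  refine (Finset.sum_le_card_nsmul _ _ _ hF).trans ?_
  have : (Finset.Icc i j).card ≤ 1 := by rw [Nat.card_Icc]; omega
  calc (Finset.Icc i j).card • B ≤ 1 • B := Nat.mul_le_mul_right _ this
    _ = B := one_smul _ _

/-- At the end of the algorithm at most one cell has not been processed. -/
theorem Inv.splitSum_bounds {k m n : ℕ} {A₀ : ℕ → ℕ} {s : State} (hs : Inv k m n A₀ s)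
    (hji : s.j ≤ s.i) (fl fr : ℕ → ℕ) (B : ℕ)
    (hB : ∀ c ∈ Finset.Icc (k + 1) n, fl (A₀ c) ≤ B ∧ fr (A₀ c) ≤ B) :
    splitSum k n A₀ fl fr s.i s.j ≤ idealCost k m n fl fr A₀ ∧
      idealCost k m n fl fr A₀ ≤ splitSum k n A₀ fl fr s.i s.j + B := by
  have hle := hs.le_i
  have hjn := hs.j_le
  have hij := hs.i_le
  have hL : numSmall k m n A₀ = _ :=
    splitSum_add_rest (fun g => if g < m then 1 else 0) (fun g => if g < m then 1 else 0)
      hle hjn hij _ (fun _ _ _ => rfl) (fun _ _ _ => rfl)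
  have hb := hs.balance
  have hrest : ∑ c ∈ Finset.Icc s.i s.j, (if A₀ c < m then 1 else 0) ≤ s.j + 1 - s.i := by
    refine (Finset.sum_le_card_nsmul _ _ 1 fun c _ => by split_ifs <;> simp).trans ?_
    simp
  -- `balance`, `hL` and `hrest` give `i - 1 ≤ k + numSmall ≤ j`, so the threshold of `idealCost`
  -- classifies every processed cell correctly.
  have key := splitSum_add_rest (A₀ := A₀) fl fr hle hjn hij
    (fun c => if c ≤ k + numSmall k m n A₀ then fl (A₀ c) else fr (A₀ c))
    (fun c h₁ h₂ => if_pos (by omega)) (fun c h₁ h₂ => if_neg (by omega))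
  have hlast := sum_Icc_le_of_le_succ (B := B) hji
    (fun c => if c ≤ k + numSmall k m n A₀ then fl (A₀ c) else fr (A₀ c)) (fun c hc => by
      rw [Finset.mem_Icc] at hc
      have := hB c (Finset.mem_Icc.mpr ⟨by omega, by omega⟩)
      split_ifs
      exacts [this.1, this.2])
  rw [idealCost, key]
  omega

/-! ### Scanned elements as a sum over processed cells -/

theorem splitSum_const_one {k n : ℕ} {A₀ : ℕ → ℕ} {i j : ℕ} :
    splitSum k n A₀ (fun _ => 1) (fun _ => 1) i j = (i - (k + 1)) + (n - j) := by
  simp [splitSum]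

theorem splitSum_add {k n : ℕ} {A₀ fl fr fl' fr' : ℕ → ℕ} {i j : ℕ} :
    splitSum k n A₀ fl fr i j + splitSum k n A₀ fl' fr' i j =
      splitSum k n A₀ (fun g => fl g + fl' g) (fun g => fr g + fr' g) i j := by
  simp only [splitSum, Finset.sum_add_distrib]; ring

theorem splitSum_sum {k n : ℕ} {A₀ : ℕ → ℕ} {i j : ℕ} {ι : Type*} (T : Finset ι)
    (fl fr : ι → ℕ → ℕ) :
    ∑ t ∈ T, splitSum k n A₀ (fl t) (fr t) i j =
      splitSum k n A₀ (fun g => ∑ t ∈ T, fl t g) (fun g => ∑ t ∈ T, fr t g) i j := by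
  simp only [splitSum, Finset.sum_add_distrib]
  rw [Finset.sum_comm, Finset.sum_comm (s := T) (t := Finset.Ioc j n)]

/-- The summand 1 stands for `i` or `j`. The border pointers moved by the element are those with `g
< t < m` or `m ≤ t < g`, and all such `t` lie in `1, …, k - 1`. -/
theorem one_add_sum_eq_scans {k m g : ℕ} (hm1 : 1 ≤ m) (hmk : m ≤ k) (hg : g ≤ k) :
    1 + ∑ t ∈ Finset.Icc 1 (k - 1),
      (if t < m then (if g < t then 1 else 0) else if t < g then 1 else 0) = scans m g := by
  have : ∀ t, (if t < m then (if g < t then 1 else 0) else if t < g then 1 else 0) =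
      if (t < m ∧ g < t) ∨ (m ≤ t ∧ t < g) then 1 else 0 := fun t => by
    split_ifs <;> omega
  simp only [this]
  rw [← Finset.card_filter, scans]
  split_ifs with h
  · have : Finset.filter (fun t => (t < m ∧ g < t) ∨ (m ≤ t ∧ t < g)) (Finset.Icc 1 (k - 1)) =
        Finset.Ioo g m := by
      ext t; simp only [Finset.mem_filter, Finset.mem_Icc, Finset.mem_Ioo]; omega
    rw [this, Nat.card_Ioo]; omega
  · have : Finset.filter (fun t => (t < m ∧ g < t) ∨ (m ≤ t ∧ t < g)) (Finset.Icc 1 (k - 1)) =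
        Finset.Ico m g := by
      ext t; simp only [Finset.mem_filter, Finset.mem_Icc, Finset.mem_Ico]; omega
    rw [this, Nat.card_Ico]; omega

theorem splitSum_congr {k n : ℕ} {A₀ fl fr fl' fr' : ℕ → ℕ} {i j : ℕ} (hi : i ≤ n + 1)
    (hj : k ≤ j) (h : ∀ c ∈ Finset.Icc (k + 1) n, fl (A₀ c) = fl' (A₀ c) ∧ fr (A₀ c) = fr' (A₀ c)) :
    splitSum k n A₀ fl fr i j = splitSum k n A₀ fl' fr' i j := by
  unfold splitSum
  congr 1
  · refine Finset.sum_congr rfl fun c hc => (h c ?_).1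
    rw [Finset.mem_Ico] at hc; rw [Finset.mem_Icc]; omega
  · refine Finset.sum_congr rfl fun c hc => (h c ?_).2
    rw [Finset.mem_Ioc] at hc; rw [Finset.mem_Icc]; omega

theorem numLeft_eq (k : ℕ) : numLeft k = (k + 2) / 2 := by
  rw [numLeft, Nat.ceilDiv_eq_add_pred_div]; omega

theorem Inv.scanned_eq {k n : ℕ} {A₀ : ℕ → ℕ} {s : State} (hk : 1 ≤ k)
    (hs : Inv k (numLeft k) n A₀ s) (hA : ∀ c ∈ Finset.Icc (k + 1) n, A₀ c ≤ k) :
    pointerCost (k + 1) s.i + pointerCost n s.j +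
      ∑ t ∈ Finset.Icc 1 (k - 1), pointerCost ((initState k n A₀).b t) (s.b t) =
    splitSum k n A₀ (scans (numLeft k)) (scans (numLeft k)) s.i s.j := by
  have hle := hs.le_i
  have hjn := hs.j_le
  have hij := hs.i_le
  have hm := numLeft_eq k
  have ht : ∀ t ∈ Finset.Icc 1 (k - 1), pointerCost ((initState k n A₀).b t) (s.b t) =
      splitSum k n A₀
        (fun g => if t < numLeft k then (if g < t then 1 else 0) else if t < g then 1 else 0)
        (fun g => if t < numLeft k then (if g < t then 1 else 0) else if t < g then 1 else 0)
        s.i s.j := by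
    intro t _
    by_cases h : t < numLeft k
    · have := hs.count_left t h
      simp only [initState, pointerCost, h, if_true]; omega
    · have := hs.count_right t (by omega)
      simp only [initState, pointerCost, h, if_false]; omega
  rw [Finset.sum_congr rfl ht, splitSum_sum]
  have h1 : pointerCost (k + 1) s.i + pointerCost n s.j =
      splitSum k n A₀ (fun _ => 1) (fun _ => 1) s.i s.j := by
    rw [splitSum_const_one, pointerCost, pointerCost]; omega
  rw [h1, splitSum_add]
  refine splitSum_congr (by omega) (by omega) fun c hc => ?_
  exact ⟨one_add_sum_eq_scans (by omega) (by omega) (hA c hc),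
    one_add_sum_eq_scans (by omega) (by omega) (hA c hc)⟩

end MultiPivot

/-! ### Relative ranks in a random permutation -/

namespace MultiPivot

open Finset

/-- The number of elements at positions in `T` that are smaller than the one at position `x`. -/
def rankIn {n : ℕ} (T : Finset (Fin n)) (σ : Equiv.Perm (Fin n)) (x : Fin n) : ℕ :=
  (T.filter fun r => σ r < σ x).card

section Rank

variable {n : ℕ} {T : Finset (Fin n)} {σ : Equiv.Perm (Fin n)} {x y : Fin n}

theorem rankIn_mul {π : Equiv.Perm (Fin n)} (hπ : ∀ r, π r ∈ T ↔ r ∈ T) :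
    rankIn T (σ * π) x = rankIn T σ (π x) := by
  unfold rankIn
  refine Finset.card_equiv π fun r => ?_
  rw [mem_filter, mem_filter, Equiv.Perm.mul_apply, Equiv.Perm.mul_apply, hπ]

theorem rankIn_lt_rankIn (hx : x ∈ T) (h : σ x < σ y) : rankIn T σ x < rankIn T σ y := by
  refine Finset.card_lt_card (Finset.ssubset_iff_of_subset ?_ |>.mpr ⟨x, ?_, ?_⟩)
  · intro r hr
    rw [mem_filter] at hr ⊢
    exact ⟨hr.1, hr.2.trans h⟩
  · simp [hx, h]
  · simp

theorem rankIn_lt_rankIn_iff (hx : x ∈ T) (hy : y ∈ T) :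
    rankIn T σ x < rankIn T σ y ↔ σ x < σ y := by
  refine ⟨fun h => ?_, rankIn_lt_rankIn hx⟩
  by_contra hc
  rcases (not_lt.mp hc).eq_or_lt with h' | h'
  · rw [σ.injective h'] at h; exact lt_irrefl _ h
  · exact absurd (rankIn_lt_rankIn hy h') (by omega)

theorem rankIn_lt_card (hx : x ∈ T) : rankIn T σ x < T.card :=
  Finset.card_lt_card (Finset.filter_ssubset.mpr ⟨x, hx, by simp⟩)

theorem rankIn_injOn : Set.InjOn (rankIn T σ) T := by
  intro x hx y hy h
  by_contra hne
  rcases lt_or_gt_of_ne (σ.injective.ne hne) with h' | h'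
  · exact absurd (rankIn_lt_rankIn hx h') (by omega)
  · exact absurd (rankIn_lt_rankIn hy h') (by omega)

theorem image_rankIn : T.image (rankIn T σ) = range T.card := by
  refine Finset.eq_of_subset_of_card_le (fun u hu => ?_) ?_
  · obtain ⟨x, hx, rfl⟩ := mem_image.mp hu
    exact mem_range.mpr (rankIn_lt_card hx)
  · rw [card_range, card_image_of_injOn rankIn_injOn]

/-- For each fixed `σ` the rank is a bijection from `T` onto `range T.card`, so summing over all
pairs of positions removes the dependence on `σ`. -/
theorem sum_offDiag_rankIn (ψ : ℕ → ℕ → ℝ) :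
    ∑ z ∈ T.offDiag, ψ (rankIn T σ z.1) (rankIn T σ z.2) =
      ∑ w ∈ (range T.card).offDiag, ψ w.1 w.2 := by
  refine Finset.sum_nbij (fun z => (rankIn T σ z.1, rankIn T σ z.2)) ?_ ?_ ?_ fun _ _ => rfl
  · intro z hz
    rw [mem_offDiag] at hz ⊢
    exact ⟨mem_range.mpr (rankIn_lt_card hz.1), mem_range.mpr (rankIn_lt_card hz.2.1),
      fun h => hz.2.2 (rankIn_injOn hz.1 hz.2.1 h)⟩
  · intro z hz w hw h
    rw [mem_coe, mem_offDiag] at hz hw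
    rw [Prod.mk.injEq] at h
    exact Prod.ext (rankIn_injOn hz.1 hw.1 h.1) (rankIn_injOn hz.2.1 hw.2.1 h.2)
  · intro w hw
    rw [mem_coe, mem_offDiag, ← image_rankIn (T := T) (σ := σ), mem_image, mem_image] at hw
    obtain ⟨⟨x, hx, hx'⟩, ⟨y, hy, hy'⟩, hne⟩ := hw
    refine ⟨(x, y), ?_, Prod.ext hx' hy'⟩
    rw [mem_coe, mem_offDiag]
    exact ⟨hx, hy, fun h => hne (by rw [← hx', ← hy', show x = y from h])⟩

theorem swap_mem_iff {a b : Fin n} (ha : a ∈ T) (hb : b ∈ T) (r : Fin n) :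
    Equiv.swap a b r ∈ T ↔ r ∈ T := by
  by_cases h₁ : r = a
  · subst h₁; simp [ha, hb]
  by_cases h₂ : r = b
  · subst h₂; simp [ha, hb]
  rw [Equiv.swap_apply_of_ne_of_ne h₁ h₂]

theorem sum_perm_rankIn_eq (ψ : ℕ → ℕ → ℝ) {z w : Fin n × Fin n} (hz : z ∈ T.offDiag)
    (hw : w ∈ T.offDiag) :
    ∑ σ : Equiv.Perm (Fin n), ψ (rankIn T σ z.1) (rankIn T σ z.2) =
      ∑ σ : Equiv.Perm (Fin n), ψ (rankIn T σ w.1) (rankIn T σ w.2) := by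
  rw [mem_offDiag] at hz hw
  obtain ⟨x, y⟩ := z
  obtain ⟨x', y'⟩ := w
  dsimp only at *
  -- The first transposition carries `x` to `x'` and `y` to `y₁ ≠ x'`; the second carries `y₁` to
  -- `y'` and fixes `x'`. Their product preserves `T`.
  set y₁ := Equiv.swap x x' y with hy₁
  have hy₁T : y₁ ∈ T := (swap_mem_iff hz.1 hw.1 y).mpr hz.2.1
  have hne : y₁ ≠ x' := fun h => hz.2.2 ((Equiv.swap x x').injective
    (by rw [Equiv.swap_apply_left, ← hy₁, h]))
  set π : Equiv.Perm (Fin n) := Equiv.swap y₁ y' * Equiv.swap x x' with hπ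
  have hπT : ∀ r, π r ∈ T ↔ r ∈ T := fun r => by
    rw [hπ, Equiv.Perm.mul_apply, swap_mem_iff hy₁T hw.2.1, swap_mem_iff hz.1 hw.1]
  have hx : π x = x' := by
    rw [hπ, Equiv.Perm.mul_apply, Equiv.swap_apply_left,
      Equiv.swap_apply_of_ne_of_ne hne.symm hw.2.2]
  have hy : π y = y' := by
    rw [hπ, Equiv.Perm.mul_apply, ← hy₁, Equiv.swap_apply_left]
  rw [← Equiv.sum_comp (Equiv.mulRight π)]
  refine Finset.sum_congr rfl fun σ _ => ?_
  rw [Equiv.coe_mulRight, rankIn_mul hπT, rankIn_mul hπT, hx, hy]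

/-- The ranks of two positions of `T` are a uniformly random pair of distinct numbers. -/
theorem card_mul_sum_perm_rankIn (ψ : ℕ → ℕ → ℝ) (hx : x ∈ T) (hy : y ∈ T) (hxy : x ≠ y) :
    (T.offDiag.card : ℝ) * ∑ σ : Equiv.Perm (Fin n), ψ (rankIn T σ x) (rankIn T σ y) =
      (n.factorial : ℝ) * ∑ w ∈ (range T.card).offDiag, ψ w.1 w.2 := by
  have hmem : (x, y) ∈ T.offDiag := by rw [mem_offDiag]; exact ⟨hx, hy, hxy⟩
  have h : ∑ z ∈ T.offDiag, ∑ σ : Equiv.Perm (Fin n), ψ (rankIn T σ z.1) (rankIn T σ z.2) =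
      ∑ _z ∈ T.offDiag, ∑ σ : Equiv.Perm (Fin n), ψ (rankIn T σ x) (rankIn T σ y) :=
    Finset.sum_congr rfl fun z hz => by
      have h₀ := sum_perm_rankIn_eq ψ hz hmem
      simpa only using h₀
  rw [sum_const, nsmul_eq_mul, Finset.sum_comm] at h
  have h' : ∑ σ : Equiv.Perm (Fin n), ∑ z ∈ T.offDiag, ψ (rankIn T σ z.1) (rankIn T σ z.2) =
      ∑ _σ : Equiv.Perm (Fin n), ∑ w ∈ (range T.card).offDiag, ψ w.1 w.2 :=
    Finset.sum_congr rfl fun σ _ => sum_offDiag_rankIn ψ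
  rw [sum_const, nsmul_eq_mul, card_univ, Fintype.card_perm, Fintype.card_fin] at h'
  exact h.symm.trans h'

end Rank

/-- The positions of the pivots. -/
def pivots (k n : ℕ) : Finset (Fin n) := univ.filter fun r => r.val < k

/-- The positions of the other elements. -/
def others (k n : ℕ) : Finset (Fin n) := univ.filter fun r => k ≤ r.val

/-- The group of the element at position `x`. -/
def group (k : ℕ) {n : ℕ} (σ : Equiv.Perm (Fin n)) (x : Fin n) : ℕ := rankIn (pivots k n) σ x

/-! ### Joint law of two groups and the expected idealized cost -/

section Group

variable {k n : ℕ}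

theorem card_pivots (h : k ≤ n) : (pivots k n).card = k := by
  rw [pivots, Fin.card_filter_val_lt, min_eq_right h]

theorem card_others (k n : ℕ) : (others k n).card = n - k := by
  have h := Finset.card_filter_add_card_filter_not (s := (univ : Finset (Fin n)))
    (fun r : Fin n => r.val < k)
  simp only [not_lt, Fin.card_filter_val_lt, card_univ, Fintype.card_fin] at h
  rw [others]; omega

theorem group_le (h : k ≤ n) (σ : Equiv.Perm (Fin n)) (x : Fin n) : group k σ x ≤ k :=
  (Finset.card_filter_le _ _).trans (card_pivots h).le

theorem swap_mem_pivots {x y : Fin n} (hx : x ∈ others k n) (hy : y ∈ others k n) (r : Fin n) :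
    Equiv.swap x y r ∈ pivots k n ↔ r ∈ pivots k n := by
  simp only [others, pivots, mem_filter, mem_univ, true_and] at *
  by_cases h₁ : r = x
  · subst h₁; rw [Equiv.swap_apply_left]; omega
  by_cases h₂ : r = y
  · subst h₂; rw [Equiv.swap_apply_right]; omega
  rw [Equiv.swap_apply_of_ne_of_ne h₁ h₂]

theorem swap_mem_others {x y : Fin n} (hx : x ∈ others k n) (hy : y ∈ others k n) (r : Fin n) :
    Equiv.swap x y r ∈ others k n ↔ r ∈ others k n := by
  have h := swap_mem_pivots hx hy r
  simp only [others, pivots, mem_filter, mem_univ, true_and] at *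
  omega

/-- Lowering the larger of two distinct ranks by one hits each pair of unequal groups once, but `(g,
g)` twice, from `(g + 1, g)` and `(g, g + 1)`. Hence the additional diagonal sum. -/
theorem sum_offDiag_shift (φ : ℕ → ℕ → ℝ) :
    ∑ w ∈ (range (k + 2)).offDiag, (if w.2 < w.1 then φ (w.1 - 1) w.2 else φ w.1 (w.2 - 1)) =
      ∑ g ∈ range (k + 1), ∑ h ∈ range (k + 1), φ g h + ∑ g ∈ range (k + 1), φ g g := by
  rw [← Finset.sum_filter_add_sum_filter_not _ (fun w : ℕ × ℕ => w.2 < w.1)]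
  have h₁ : ∑ w ∈ (range (k + 2)).offDiag.filter (fun w : ℕ × ℕ => w.2 < w.1),
      (if w.2 < w.1 then φ (w.1 - 1) w.2 else φ w.1 (w.2 - 1)) =
      ∑ w ∈ (range (k + 1) ×ˢ range (k + 1)).filter (fun w : ℕ × ℕ => w.2 ≤ w.1), φ w.1 w.2 := by
    refine Finset.sum_nbij' (fun w => (w.1 - 1, w.2)) (fun w => (w.1 + 1, w.2)) ?_ ?_ ?_ ?_ ?_
    all_goals
      rintro ⟨u, v⟩ hw
      simp only [mem_filter, mem_offDiag, mem_product, mem_range] at hw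
    · simp only [mem_filter, mem_product, mem_range]; omega
    · simp only [mem_filter, mem_offDiag, mem_range]; omega
    · ext <;> simp only; omega
    · ext <;> simp only; omega
    · rw [if_pos hw.2]
  have h₂ : ∑ w ∈ (range (k + 2)).offDiag.filter (fun w : ℕ × ℕ => ¬w.2 < w.1),
      (if w.2 < w.1 then φ (w.1 - 1) w.2 else φ w.1 (w.2 - 1)) =
      ∑ w ∈ (range (k + 1) ×ˢ range (k + 1)).filter (fun w : ℕ × ℕ => ¬w.2 ≤ w.1), φ w.1 w.2 +
        ∑ g ∈ range (k + 1), φ g g := by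
    have : ∑ g ∈ range (k + 1), φ g g =
        ∑ w ∈ (range (k + 1) ×ˢ range (k + 1)).filter (fun w : ℕ × ℕ => w.1 = w.2), φ w.1 w.2 := by
      refine Finset.sum_nbij' (fun g => (g, g)) (fun w => w.1) ?_ ?_ ?_ ?_ ?_
      · intro g hg; simpa using hg
      · intro w hw; rw [mem_filter, mem_product] at hw; exact hw.1.1
      · intro g _; rfl
      · intro w hw; rw [mem_filter] at hw; exact Prod.ext rfl hw.2
      · intro g _; rfl
    rw [this, ← Finset.sum_union]
    · refine Finset.sum_nbij' (fun w => (w.1, w.2 - 1)) (fun w => (w.1, w.2 + 1)) ?_ ?_ ?_ ?_ ?_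
      all_goals
        rintro ⟨u, v⟩ hw
        simp only [mem_filter, mem_offDiag, mem_product, mem_range, mem_union] at hw
      · simp only [mem_filter, mem_product, mem_range, mem_union]; omega
      · simp only [mem_filter, mem_offDiag, mem_range]; omega
      · ext <;> simp only; omega
      · ext <;> simp only; omega
      · rw [if_neg hw.2]
    · refine Finset.disjoint_left.mpr fun w hw hw' => ?_
      rw [mem_filter] at hw hw'; omega
  rw [h₁, h₂, ← add_assoc, Finset.sum_filter_add_sum_filter_not, Finset.sum_product]

/-- The joint law of the groups of two elements that are not pivots. -/
theorem sum_perm_group_pair (hk : k ≤ n) (φ : ℕ → ℕ → ℝ) {x y : Fin n} (hx : x ∈ others k n)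
    (hy : y ∈ others k n) (hxy : x ≠ y) :
    ((k : ℝ) + 1) * ((k : ℝ) + 2) * ∑ σ : Equiv.Perm (Fin n), φ (group k σ x) (group k σ y) =
      (n.factorial : ℝ) * (∑ g ∈ range (k + 1), ∑ h ∈ range (k + 1), φ g h +
        ∑ g ∈ range (k + 1), φ g g) := by
  set T := insert x (insert y (pivots k n)) with hT
  have hxp : x ∉ pivots k n := by
    simp only [others, pivots, mem_filter, mem_univ, true_and] at *; omega
  have hyp : y ∉ pivots k n := by
    simp only [others, pivots, mem_filter, mem_univ, true_and] at *; omega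
  have hxi : x ∉ insert y (pivots k n) := by simp [hxy, hxp]
  have hxT : x ∈ T := mem_insert_self _ _
  have hyT : y ∈ T := mem_insert_of_mem (mem_insert_self _ _)
  have hcard : T.card = k + 2 := by
    rw [hT, card_insert_of_notMem hxi, card_insert_of_notMem hyp, card_pivots hk]
  have hrx : ∀ σ, rankIn T σ x = group k σ x + if σ y < σ x then 1 else 0 := fun σ => by
    rw [group, rankIn, rankIn, hT, filter_insert, if_neg (lt_irrefl _), filter_insert]
    split_ifs
    · rw [card_insert_of_notMem (by simp [hyp])]
    · rfl
  have hry : ∀ σ, rankIn T σ y = group k σ y + if σ x < σ y then 1 else 0 := fun σ => by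
    rw [group, rankIn, rankIn, hT, Finset.insert_comm, filter_insert, if_neg (lt_irrefl _),
      filter_insert]
    split_ifs
    · rw [card_insert_of_notMem (by simp [hxp])]
    · rfl
  -- By `hrx` and `hry` the rank in `T` exceeds the group by one for the larger of the two elements;
  -- this test function undoes the shift.
  have key := card_mul_sum_perm_rankIn
    (fun u v => if v < u then φ (u - 1) v else φ u (v - 1)) hxT hyT hxy
  rw [hcard, sum_offDiag_shift, offDiag_card, hcard] at key
  rw [← key]
  congr 1
  · have : (k + 2) * (k + 2) - (k + 2) = (k + 1) * (k + 2) := by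
      rw [← Nat.sub_one_mul]; rfl
    rw [this]; push_cast; ring
  · refine Finset.sum_congr rfl fun σ _ => ?_
    have hiff := rankIn_lt_rankIn_iff (σ := σ) hyT hxT
    have hne : σ x ≠ σ y := σ.injective.ne hxy
    rcases lt_or_gt_of_ne hne with h | h
    · rw [if_neg (by rw [hiff]; exact not_lt.mpr h.le), hrx, hry, if_neg (not_lt.mpr h.le),
        if_pos h, Nat.add_sub_cancel, add_zero]
    · rw [if_pos (hiff.mpr h), hrx, hry, if_neg (not_lt.mpr h.le),
        if_pos h, Nat.add_sub_cancel, add_zero]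

/-- The number of elements in groups less than `m`. -/
def small (k m : ℕ) {n : ℕ} (σ : Equiv.Perm (Fin n)) : ℕ :=
  ((others k n).filter fun x => group k σ x < m).card

/-- The idealized cost in terms of the permutation. -/
def permCost (k m : ℕ) (fl fr : ℕ → ℝ) {n : ℕ} (σ : Equiv.Perm (Fin n)) : ℝ :=
  ∑ x ∈ others k n, if x.val < k + small k m σ then fl (group k σ x) else fr (group k σ x)

theorem group_mul_swap {x y : Fin n} (hx : x ∈ others k n) (hy : y ∈ others k n)
    (σ : Equiv.Perm (Fin n)) (z : Fin n) :
    group k (σ * Equiv.swap x y) z = group k σ (Equiv.swap x y z) :=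
  rankIn_mul (swap_mem_pivots hx hy)

theorem small_mul_swap (m : ℕ) {x y : Fin n} (hx : x ∈ others k n) (hy : y ∈ others k n)
    (σ : Equiv.Perm (Fin n)) : small k m (σ * Equiv.swap x y) = small k m σ := by
  refine Finset.card_equiv (Equiv.swap x y) fun r => ?_
  rw [mem_filter, mem_filter, swap_mem_others hx hy, group_mul_swap hx hy]

/-- Swapping two non-pivot positions permutes the permutations, preserves `small` and exchanges the
two groups. -/
theorem sum_perm_swap (m : ℕ) (G : ℕ → ℕ → ℝ) {x y : Fin n} (hx : x ∈ others k n)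
    (hy : y ∈ others k n) : ∑ σ : Equiv.Perm (Fin n), G (small k m σ) (group k σ x) =
      ∑ σ : Equiv.Perm (Fin n), G (small k m σ) (group k σ y) := by
  rw [← Equiv.sum_comp (Equiv.mulRight (Equiv.swap x y))]
  refine Finset.sum_congr rfl fun σ _ => ?_
  rw [Equiv.coe_mulRight, small_mul_swap m hx hy, group_mul_swap hx hy, Equiv.swap_apply_left]

/-- Each condition holds for exactly `small k m σ` positions. This trades the position threshold for
the group of a second element. -/
theorem sum_others_lt (m : ℕ) (σ : Equiv.Perm (Fin n)) (a b : ℝ) :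
    ∑ x ∈ others k n, (if x.val < k + small k m σ then a else b) =
      ∑ x ∈ others k n, if group k σ x < m then a else b := by
  have hc : ((others k n).filter fun x => x.val < k + small k m σ).card = small k m σ := by
    have hle : small k m σ ≤ n - k := (Finset.card_filter_le _ _).trans (card_others k n).le
    have : ((others k n).filter fun x => x.val < k + small k m σ).card =
        (Finset.Ico k (k + small k m σ)).card := by
      refine Finset.card_nbij (fun x => x.val) ?_ ?_ ?_
      · intro x hx
        simp only [others, mem_filter, mem_univ, true_and, Finset.mem_Ico, mem_coe] at hx ⊢
        exact hx
      · exact fun x _ y _ h => Fin.ext h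
      · intro c hc
        simp only [coe_Ico, Set.mem_Ico] at hc
        refine ⟨⟨c, by omega⟩, ?_, rfl⟩
        simp only [others, coe_filter, mem_filter, mem_univ, true_and, Set.mem_ofPred_eq]
        exact hc
    rw [this, Nat.card_Ico]; omega
  have hn : ∀ p : Fin n → Prop, ∀ _ : DecidablePred p,
      ∑ x ∈ others k n, (if p x then a else b) =
      ((others k n).filter p).card * (a - b) + (others k n).card * b := fun p _ => by
    rw [← Finset.sum_filter_add_sum_filter_not _ p,
      ← Finset.card_filter_add_card_filter_not (s := others k n) p,
      Finset.sum_congr rfl (fun x hx => if_pos (mem_filter.mp hx).2),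
      Finset.sum_congr rfl (fun x hx => if_neg (mem_filter.mp hx).2)]
    simp only [sum_const, nsmul_eq_mul]; push_cast; ring
  rw [hn, hn, hc, small]

/-- By symmetry, the groups of cell contents are independent of the cell. -/
theorem card_mul_sum_permCost (m : ℕ) (fl fr : ℕ → ℝ) :
    ((others k n).card : ℝ) * ∑ σ : Equiv.Perm (Fin n), permCost k m fl fr σ =
      ∑ x ∈ others k n, ∑ y ∈ others k n, ∑ σ : Equiv.Perm (Fin n),
        if group k σ y < m then fl (group k σ x) else fr (group k σ x) := by
  have h₁ : ∑ σ : Equiv.Perm (Fin n), permCost k m fl fr σ = ∑ y ∈ others k n,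
      ∑ σ : Equiv.Perm (Fin n),
        if y.val < k + small k m σ then fl (group k σ y) else fr (group k σ y) := by
    simp only [permCost]; rw [Finset.sum_comm]
  -- The factor becomes a sum over `x`. For fixed `x`, exchangeability replaces the group at `y` by
  -- that at `x`, so `y` then enters only through the threshold.
  rw [h₁, ← nsmul_eq_mul, ← Finset.sum_const]
  refine Finset.sum_congr rfl fun x hx => ?_
  have h₂ : ∀ y ∈ others k n, ∑ σ : Equiv.Perm (Fin n),
      (if y.val < k + small k m σ then fl (group k σ y) else fr (group k σ y)) =
      ∑ σ : Equiv.Perm (Fin n),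
        if y.val < k + small k m σ then fl (group k σ x) else fr (group k σ x) := fun y hy =>
    sum_perm_swap m (fun l g => if y.val < k + l then fl g else fr g) hy hx
  rw [Finset.sum_congr rfl h₂, Finset.sum_comm, Finset.sum_comm (s := others k n)]
  exact Finset.sum_congr rfl fun σ _ => sum_others_lt m σ _ _

/-- The leading coefficient of the expected cost. -/
noncomputable def rate (k m : ℕ) (fl fr : ℕ → ℝ) : ℝ :=
  (∑ g ∈ range (k + 1), ∑ h ∈ range (k + 1), (if h < m then fl g else fr g) +
    ∑ g ∈ range (k + 1), if g < m then fl g else fr g) / (((k : ℝ) + 1) * ((k : ℝ) + 2))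

/-- Each of the `N = n - k` elements has `N - 1` partners, each contributing `n! * rate`. The
diagonal terms are at most `n! * B` in absolute value, so division by `N * n!` leaves an error of at
most `B`. -/
theorem abs_sum_permCost_sub_le (hk : k < n) (m : ℕ) (fl fr : ℕ → ℝ) {B : ℝ}
    (hl : ∀ g ≤ k, |fl g| ≤ B) (hr : ∀ g ≤ k, |fr g| ≤ B) :
    |(∑ σ : Equiv.Perm (Fin n), permCost k m fl fr σ) / (n.factorial : ℝ) -
      ((n : ℝ) - k - 1) * rate k m fl fr| ≤ B := by
  have hpos : (0 : ℝ) < ((k : ℝ) + 1) * ((k : ℝ) + 2) := by positivity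
  have hfac : (0 : ℝ) < n.factorial := by exact_mod_cast n.factorial_pos
  have hN : ((others k n).card : ℝ) = (n : ℝ) - k := by
    rw [card_others, Nat.cast_sub hk.le]
  have hNpos : (0 : ℝ) < (n : ℝ) - k := by
    have : (k : ℝ) < n := by exact_mod_cast hk
    linarith
  have hpair : ∀ x ∈ others k n, ∀ y ∈ (others k n).erase x, ∑ σ : Equiv.Perm (Fin n),
      (if group k σ y < m then fl (group k σ x) else fr (group k σ x)) =
        n.factorial * rate k m fl fr := by
    intro x hx y hy
    rw [mem_erase] at hy
    have := sum_perm_group_pair hk.le (fun g h => if h < m then fl g else fr g) hx hy.2 hy.1.symm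
    rw [rate, mul_div_assoc', ← this]
    field_simp
  have hmul := card_mul_sum_permCost (k := k) (n := n) m fl fr
  have hsplit : ∀ x ∈ others k n, ∑ y ∈ others k n, ∑ σ : Equiv.Perm (Fin n),
      (if group k σ y < m then fl (group k σ x) else fr (group k σ x)) =
        ((n : ℝ) - k - 1) * (n.factorial * rate k m fl fr) + ∑ σ : Equiv.Perm (Fin n),
          (if group k σ x < m then fl (group k σ x) else fr (group k σ x)) := by
    intro x hx
    rw [← Finset.sum_erase_add _ _ hx, Finset.sum_congr rfl (hpair x hx), sum_const,
      nsmul_eq_mul, card_erase_of_mem hx,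
      Nat.cast_sub (Finset.card_pos.mpr ⟨x, hx⟩), hN, Nat.cast_one]
  rw [Finset.sum_congr rfl hsplit, Finset.sum_add_distrib, sum_const, nsmul_eq_mul, hN] at hmul
  set R := ∑ x ∈ others k n, ∑ σ : Equiv.Perm (Fin n),
    (if group k σ x < m then fl (group k σ x) else fr (group k σ x)) with hR
  have hRle : |R| ≤ ((n : ℝ) - k) * (n.factorial * B) := by
    rw [hR, ← hN, ← nsmul_eq_mul]
    refine (Finset.abs_sum_le_sum_abs _ _).trans (Finset.sum_le_card_nsmul _ _ _ fun x _ => ?_)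
    refine (Finset.abs_sum_le_sum_abs _ _).trans ?_
    refine (Finset.sum_le_card_nsmul _ _ B fun σ _ => ?_).trans_eq ?_
    · have := group_le hk.le σ x
      split_ifs
      exacts [hl _ this, hr _ this]
    · rw [card_univ, Fintype.card_perm, Fintype.card_fin, nsmul_eq_mul]
  have heq : (∑ σ : Equiv.Perm (Fin n), permCost k m fl fr σ) / (n.factorial : ℝ) -
      ((n : ℝ) - k - 1) * rate k m fl fr = R / (((n : ℝ) - k) * n.factorial) := by
    rw [eq_div_iff (mul_pos hNpos hfac).ne']
    field_simp
    linear_combination hmul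
  rw [heq, abs_div, abs_of_pos (mul_pos hNpos hfac), div_le_iff₀ (mul_pos hNpos hfac)]
  linarith

end Group

end MultiPivot

/-! ### Expected costs of the algorithm -/

namespace MultiPivot

open Finset

theorem inputArray_succ (k : ℕ) {n : ℕ} (σ : Equiv.Perm (Fin n)) (x : Fin n) :
    inputArray k n σ (x.val + 1) = group k σ x := by
  simp only [inputArray, Nat.add_sub_cancel, x.isLt, dif_pos, group, rankIn, pivots,
    Finset.filter_filter]

theorem sum_Icc_eq_sum_others {M : Type*} [AddCommMonoid M] (k n : ℕ) (F : ℕ → M) :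
    ∑ c ∈ Finset.Icc (k + 1) n, F c = ∑ x ∈ others k n, F (x.val + 1) := by
  symm
  refine Finset.sum_nbij (fun x => x.val + 1) ?_ ?_ ?_ fun _ _ => rfl
  · intro x hx
    have := x.isLt
    simp only [others, mem_filter, mem_univ, true_and, Finset.mem_Icc] at hx ⊢
    omega
  · exact fun x _ y _ h => Fin.ext (Nat.succ_injective h)
  · intro c hc
    simp only [coe_Icc, Set.mem_Icc] at hc
    refine ⟨⟨c - 1, by omega⟩, ?_, Nat.sub_add_cancel (by omega)⟩
    simp only [others, coe_filter, mem_univ, true_and, Set.mem_ofPred_eq]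
    omega

theorem numSmall_inputArray (k m : ℕ) {n : ℕ} (σ : Equiv.Perm (Fin n)) :
    numSmall k m n (inputArray k n σ) = small k m σ := by
  rw [numSmall, sum_Icc_eq_sum_others, small, Finset.card_filter]
  simp only [inputArray_succ]

theorem idealCost_inputArray (k m : ℕ) (fl fr : ℕ → ℕ) {n : ℕ} (σ : Equiv.Perm (Fin n)) :
    (idealCost k m n fl fr (inputArray k n σ) : ℝ) =
      permCost k m (fun g => (fl g : ℝ)) (fun g => (fr g : ℝ)) σ := by
  rw [idealCost, sum_Icc_eq_sum_others, permCost, numSmall_inputArray]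
  push_cast
  simp only [inputArray_succ, Nat.succ_le_iff]

theorem inputArray_le {k n : ℕ} (h : k ≤ n) (σ : Equiv.Perm (Fin n)) :
    ∀ c ∈ Finset.Icc (k + 1) n, inputArray k n σ c ≤ k := by
  intro c hc
  rw [Finset.mem_Icc] at hc
  have := inputArray_succ k σ ⟨c - 1, by omega⟩
  rw [show (⟨c - 1, by omega⟩ : Fin n).val + 1 = c by simp only; omega] at this
  rw [this]
  exact group_le h _ _

/-- A cost that is a `splitSum` in the final state of the algorithm has linear expected value. -/
theorem expectedCost_sub_isBigO (k : ℕ) (fl fr : ℕ → ℕ)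
    (X : ∀ n : ℕ, Equiv.Perm (Fin n) → ℕ)
    (hX : ∀ n, k < n → ∀ σ : Equiv.Perm (Fin n), X n σ =
      splitSum k n (inputArray k n σ) fl fr (exchange k n (inputArray k n σ)).i
        (exchange k n (inputArray k n σ)).j)
    {κ : ℝ} (hκ : rate k (numLeft k) (fun g => (fl g : ℝ)) (fun g => (fr g : ℝ)) = κ) :
    (fun n : ℕ => expectedCost n (X n) - κ * (n : ℝ)) =O[Filter.atTop] (fun _ : ℕ => (1 : ℝ)) := by
  obtain ⟨B, hB⟩ : ∃ B : ℕ, ∀ g ≤ k, fl g ≤ B ∧ fr g ≤ B := by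
    refine ⟨∑ g ∈ range (k + 1), (fl g + fr g), fun g hg => ?_⟩
    have := Finset.single_le_sum (f := fun g => fl g + fr g) (fun _ _ => Nat.zero_le _)
      (mem_range.mpr (show g < k + 1 by omega))
    omega
  -- One `B` for the unprocessed cell, one for the diagonal pairs, and the last term for replacing
  -- `n - k - 1` by `n`.
  refine Asymptotics.IsBigO.of_bound (2 * B + ((k : ℝ) + 1) * |κ|) ?_
  filter_upwards [Filter.eventually_gt_atTop k] with n hn
  have hfac : (0 : ℝ) < n.factorial := by exact_mod_cast n.factorial_pos
  have h₁ := abs_sum_permCost_sub_le hn (numLeft k) (fun g => (fl g : ℝ)) (fun g => (fr g : ℝ))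
    (B := B) (fun g hg => by rw [Nat.abs_cast]; exact_mod_cast (hB g hg).1)
    (fun g hg => by rw [Nat.abs_cast]; exact_mod_cast (hB g hg).2)
  rw [hκ] at h₁
  have h₂ : |expectedCost n (X n) - (∑ σ : Equiv.Perm (Fin n),
      permCost k (numLeft k) (fun g => (fl g : ℝ)) (fun g => (fr g : ℝ)) σ) /
        (n.factorial : ℝ)| ≤ B := by
    rw [expectedCost, ← sub_div, ← Finset.sum_sub_distrib, abs_div, abs_of_pos hfac,
      div_le_iff₀ hfac]
    refine (Finset.abs_sum_le_sum_abs _ _).trans ?_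
    refine (Finset.sum_le_card_nsmul _ _ (B : ℝ) fun σ _ => ?_).trans_eq ?_
    · have hinv := (Inv.init (k := k) (n := n) (A₀ := inputArray k n σ) hn).outerLoop
      have hb := hinv.1.splitSum_bounds hinv.2 fl fr B
        fun c hc => hB _ (inputArray_le hn.le σ c hc)
      have hXσ := hX n hn σ
      rw [exchange] at hXσ
      rw [← hXσ] at hb
      rw [← idealCost_inputArray, abs_le]
      have h1 : (X n σ : ℝ) ≤ _ := Nat.cast_le.mpr hb.1
      have h2 : (_ : ℝ) ≤ _ := Nat.cast_le.mpr hb.2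
      push_cast at h2
      constructor <;> linarith
    · rw [card_univ, Fintype.card_perm, Fintype.card_fin, nsmul_eq_mul, mul_comm]
  rw [norm_one, mul_one, Real.norm_eq_abs]
  have h₃ : |((k : ℝ) + 1) * κ| = ((k : ℝ) + 1) * |κ| := by
    rw [abs_mul, abs_of_pos (by positivity)]
  rw [← h₃]
  rw [abs_le] at h₁ h₂ ⊢
  have h₄ := le_abs_self (((k : ℝ) + 1) * κ)
  have h₅ := neg_abs_le (((k : ℝ) + 1) * κ)
  constructor <;> nlinarith

theorem scanned_eq_splitSum {k n : ℕ} (hk : 1 ≤ k) (hn : k < n) (σ : Equiv.Perm (Fin n)) :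
    scanned k n σ = splitSum k n (inputArray k n σ) (scans (numLeft k)) (scans (numLeft k))
      (exchange k n (inputArray k n σ)).i (exchange k n (inputArray k n σ)).j :=
  (Inv.init hn).outerLoop.1.scanned_eq hk (inputArray_le hn.le σ)

theorem writeAccesses_eq_splitSum {k n : ℕ} (hn : k < n) (σ : Equiv.Perm (Fin n)) :
    writeAccesses k n σ =
      splitSum k n (inputArray k n σ) (writesLeft (numLeft k)) (writesRight (numLeft k))
        (exchange k n (inputArray k n σ)).i (exchange k n (inputArray k n σ)).j :=
  (Inv.init hn).outerLoop.1.writes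

theorem assignments_eq_splitSum {k n : ℕ} (hn : k < n) (σ : Equiv.Perm (Fin n)) :
    assignments k n σ =
      splitSum k n (inputArray k n σ) (assignsLeft (numLeft k)) (assignsRight (numLeft k))
        (exchange k n (inputArray k n σ)).i (exchange k n (inputArray k n σ)).j :=
  (Inv.init hn).outerLoop.1.assigns

/-! ### Closed forms of the leading coefficients -/

/-- On both sides `u` is the distance from the innermost group, which makes the costs of the form `u
+ 1` up to small corrections. The weights count the groups of the second element, plus one from the
diagonal. -/
theorem rate_eq {k m r : ℕ} (h : k + 1 = m + r) (fl fr : ℕ → ℝ) :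
    rate k m fl fr = (((m : ℝ) + 1) * ∑ u ∈ range m, fl (m - 1 - u) +
      r * ∑ u ∈ range m, fr (m - 1 - u) + m * ∑ u ∈ range r, fl (m + u) +
      ((r : ℝ) + 1) * ∑ u ∈ range r, fr (m + u)) / (((k : ℝ) + 1) * ((k : ℝ) + 2)) := by
  have hsplit : ∀ a b : ℕ → ℝ, ∑ g ∈ range (k + 1), (if g < m then a g else b g) =
      ∑ g ∈ range m, a g + ∑ u ∈ range r, b (m + u) := fun a b => by
    rw [h, Finset.sum_range_add]
    congr 1
    · exact Finset.sum_congr rfl fun g hg => if_pos (mem_range.mp hg)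
    · exact Finset.sum_congr rfl fun u _ => if_neg (by omega)
  have hinner : ∀ g, ∑ h ∈ range (k + 1), (if h < m then fl g else fr g) = m * fl g + r * fr g :=
    fun g => by
      rw [hsplit (fun _ => fl g) (fun _ => fr g)]; simp
  rw [rate]
  congr 1
  rw [Finset.sum_congr rfl fun g _ => hinner g, hsplit, Finset.sum_range_reflect fl m,
    Finset.sum_range_reflect fr m, h, Finset.sum_range_add]
  simp only [Finset.sum_add_distrib, ← Finset.mul_sum]
  ring

theorem sum_range_succ_cast (M : ℕ) : ∑ u ∈ range M, ((u : ℝ) + 1) = M * (M + 1) / 2 := by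
  induction M with
  | zero => simp
  | succ M ih => rw [Finset.sum_range_succ, ih]; push_cast; ring

/-- Used for elements read on their own side, where the innermost group `u = 0` needs no rotation.
-/
theorem sum_range_ite_zero {M : ℕ} (hM : 1 ≤ M) (c : ℝ) :
    ∑ u ∈ range M, (if u = 0 then 0 else (u : ℝ) + 1 + c) =
      M * (M + 1) / 2 + M * c - 1 - c := by
  obtain ⟨N, rfl⟩ := Nat.exists_eq_add_of_le' hM
  rw [Finset.sum_range_succ', Finset.sum_congr rfl fun u _ => if_neg (Nat.succ_ne_zero u),
    if_pos rfl, Finset.sum_add_distrib, sum_const, card_range, nsmul_eq_mul]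
  have := sum_range_succ_cast N
  rw [Finset.sum_add_distrib, sum_const, card_range, nsmul_eq_mul] at this
  push_cast
  rw [Finset.sum_add_distrib, Finset.sum_add_distrib]
  simp only [sum_const, card_range, nsmul_eq_mul]
  linarith

section Rates

variable {k m r : ℕ}

theorem sum_scans_left (m : ℕ) :
    ∑ u ∈ range m, (scans m (m - 1 - u) : ℝ) = m * (m + 1) / 2 := by
  rw [← sum_range_succ_cast]
  refine Finset.sum_congr rfl fun u hu => ?_
  rw [mem_range] at hu
  have : scans m (m - 1 - u) = u + 1 := by unfold scans; split_ifs <;> omega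
  rw [this]; push_cast; ring

theorem sum_scans_right (m r : ℕ) :
    ∑ u ∈ range r, (scans m (m + u) : ℝ) = r * (r + 1) / 2 := by
  rw [← sum_range_succ_cast]
  refine Finset.sum_congr rfl fun u _ => ?_
  have : scans m (m + u) = u + 1 := by unfold scans; split_ifs <;> omega
  rw [this]; push_cast; ring

theorem sum_writesRight_left (m : ℕ) :
    ∑ u ∈ range m, (writesRight m (m - 1 - u) : ℝ) = m * (m + 1) / 2 := by
  rw [← sum_range_succ_cast]
  refine Finset.sum_congr rfl fun u hu => ?_
  rw [mem_range] at hu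
  have : writesRight m (m - 1 - u) = u + 1 := by unfold writesRight; split_ifs <;> omega
  rw [this]; push_cast; ring

theorem sum_writesLeft_right (m r : ℕ) :
    ∑ u ∈ range r, (writesLeft m (m + u) : ℝ) = r * (r + 1) / 2 := by
  rw [← sum_range_succ_cast]
  refine Finset.sum_congr rfl fun u _ => ?_
  have : writesLeft m (m + u) = u + 1 := by unfold writesLeft; split_ifs <;> omega
  rw [this]; push_cast; ring

theorem sum_writesLeft_left (hm : 1 ≤ m) :
    ∑ u ∈ range m, (writesLeft m (m - 1 - u) : ℝ) = m * (m + 1) / 2 - 1 := by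
  have h := sum_range_ite_zero hm 0
  rw [mul_zero, add_zero, sub_zero] at h
  rw [← h]
  refine Finset.sum_congr rfl fun u hu => ?_
  rw [mem_range] at hu
  have : writesLeft m (m - 1 - u) = if u = 0 then 0 else u + 1 := by
    unfold writesLeft; split_ifs <;> omega
  rw [this]; push_cast; split_ifs <;> ring

theorem sum_writesRight_right (m : ℕ) (hr : 1 ≤ r) :
    ∑ u ∈ range r, (writesRight m (m + u) : ℝ) = r * (r + 1) / 2 - 1 := by
  have h := sum_range_ite_zero hr 0
  rw [mul_zero, add_zero, sub_zero] at h
  rw [← h]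
  refine Finset.sum_congr rfl fun u hu => ?_
  have : writesRight m (m + u) = if u = 0 then 0 else u + 1 := by
    unfold writesRight; split_ifs <;> omega
  rw [this]; push_cast; split_ifs <;> ring

theorem sum_assignsRight_left (m : ℕ) :
    ∑ u ∈ range m, (assignsRight m (m - 1 - u) : ℝ) = m * (m + 1) / 2 + m := by
  have h : ∑ u ∈ range m, (((u : ℝ) + 1) + 1) = m * (m + 1) / 2 + m := by
    rw [Finset.sum_add_distrib, sum_range_succ_cast]; simp
  rw [← h]
  refine Finset.sum_congr rfl fun u hu => ?_
  rw [mem_range] at hu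
  have : assignsRight m (m - 1 - u) = u + 1 + 1 := by unfold assignsRight; split_ifs <;> omega
  rw [this]; push_cast; ring

theorem sum_assignsLeft_right (m r : ℕ) :
    ∑ u ∈ range r, (assignsLeft m (m + u) : ℝ) = r * (r + 1) / 2 := by
  rw [← sum_range_succ_cast]
  refine Finset.sum_congr rfl fun u _ => ?_
  have : assignsLeft m (m + u) = u + 1 := by unfold assignsLeft; split_ifs <;> omega
  rw [this]; push_cast; ring

theorem sum_assignsLeft_left (hm : 1 ≤ m) :
    ∑ u ∈ range m, (assignsLeft m (m - 1 - u) : ℝ) = m * (m + 1) / 2 + m - 2 := by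
  have h := sum_range_ite_zero hm 1
  rw [show (m : ℝ) * (m + 1) / 2 + m - 2 = m * (m + 1) / 2 + m * 1 - 1 - 1 by ring, ← h]
  refine Finset.sum_congr rfl fun u hu => ?_
  rw [mem_range] at hu
  have : assignsLeft m (m - 1 - u) = if u = 0 then 0 else u + 1 + 1 := by
    unfold assignsLeft; split_ifs <;> omega
  rw [this]; push_cast; split_ifs <;> ring

theorem sum_assignsRight_right (m : ℕ) (hr : 1 ≤ r) :
    ∑ u ∈ range r, (assignsRight m (m + u) : ℝ) = r * (r + 1) / 2 + r - 2 := by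
  have h := sum_range_ite_zero hr 1
  rw [show (r : ℝ) * (r + 1) / 2 + r - 2 = r * (r + 1) / 2 + r * 1 - 1 - 1 by ring, ← h]
  refine Finset.sum_congr rfl fun u hu => ?_
  have : assignsRight m (m + u) = if u = 0 then 0 else u + 1 + 1 := by
    unfold assignsRight; split_ifs <;> omega
  rw [this]; push_cast; split_ifs <;> ring

theorem rate_scans (h : k + 1 = m + r) :
    rate k m (fun g => (scans m g : ℝ)) (fun g => (scans m g : ℝ)) =
      ((m : ℝ) * (m + 1) + r * (r + 1)) / (2 * ((m : ℝ) + r)) := by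
  have hk : (k : ℝ) + 1 = m + r := by exact_mod_cast h
  have hpos : (0 : ℝ) < (m : ℝ) + r := hk ▸ by positivity
  rw [rate_eq h, sum_scans_left, sum_scans_right, show (k : ℝ) + 2 = m + r + 1 by linarith, hk]
  field_simp
  ring

/-- Writes agree with scans except that groups `m - 1` read by `i` and `m` read by `j` save one
each; their weights `m + 1` and `r + 1` give the subtracted term. -/
theorem rate_writes (h : k + 1 = m + r) (hm : 1 ≤ m) (hr : 1 ≤ r) :
    rate k m (fun g => (writesLeft m g : ℝ)) (fun g => (writesRight m g : ℝ)) =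
      ((m : ℝ) * (m + 1) + r * (r + 1)) / (2 * ((m : ℝ) + r)) -
        ((m : ℝ) + r + 2) / (((m : ℝ) + r) * (m + r + 1)) := by
  have hk : (k : ℝ) + 1 = m + r := by exact_mod_cast h
  have hpos : (0 : ℝ) < (m : ℝ) + r := hk ▸ by positivity
  rw [rate_eq h, sum_writesLeft_left hm, sum_writesLeft_right, sum_writesRight_left,
    sum_writesRight_right m hr, show (k : ℝ) + 2 = m + r + 1 by linarith, hk]
  field_simp
  ring

/-- Compared with scans, elements rotated on their own side cost one more and the innermost group
saves one, giving `m - 2` and `r - 2`. The term `r * m` is the additional assignment per exchange.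
-/
theorem rate_assigns (h : k + 1 = m + r) (hm : 1 ≤ m) (hr : 1 ≤ r) :
    rate k m (fun g => (assignsLeft m g : ℝ)) (fun g => (assignsRight m g : ℝ)) =
      ((m : ℝ) * (m + 1) + r * (r + 1)) / (2 * ((m : ℝ) + r)) +
        (((m : ℝ) + 1) * (m - 2) + r * m + (r + 1) * (r - 2)) / (((m : ℝ) + r) * (m + r + 1)) := by
  have hk : (k : ℝ) + 1 = m + r := by exact_mod_cast h
  have hpos : (0 : ℝ) < (m : ℝ) + r := hk ▸ by positivity
  rw [rate_eq h, sum_assignsLeft_left hm, sum_assignsLeft_right, sum_assignsRight_left,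
    sum_assignsRight_right m hr, show (k : ℝ) + 2 = m + r + 1 by linarith, hk]
  field_simp
  ring

end Rates

end MultiPivot

theorem mainTheorem7 (k : ℕ) (hk : 1 ≤ k) (m : ℕ) (hm : m = (k + 1) ⌈/⌉ 2) :
    (Odd k →
      (fun n : ℕ => MultiPivot.expectedCost n (MultiPivot.scanned k n)
          - ((m : ℝ) + 1) / 2 * (n : ℝ)) =O[Filter.atTop] (fun _ : ℕ => (1 : ℝ)) ∧
      (fun n : ℕ => MultiPivot.expectedCost n (MultiPivot.writeAccesses k n)
          - (2 * (m : ℝ) ^ 3 + 3 * (m : ℝ) ^ 2 - (m : ℝ) - 2) / (2 * (m : ℝ) * (2 * (m : ℝ) + 1))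
            * (n : ℝ)) =O[Filter.atTop] (fun _ : ℕ => (1 : ℝ)) ∧
      (fun n : ℕ => MultiPivot.expectedCost n (MultiPivot.assignments k n)
          - (2 * (m : ℝ) ^ 3 + 6 * (m : ℝ) ^ 2 - (m : ℝ) - 4) / (2 * (m : ℝ) * (2 * (m : ℝ) + 1))
            * (n : ℝ)) =O[Filter.atTop] (fun _ : ℕ => (1 : ℝ))) ∧
    (Even k →
      (fun n : ℕ => MultiPivot.expectedCost n (MultiPivot.scanned k n)
          - (m : ℝ) ^ 2 / (2 * (m : ℝ) - 1) * (n : ℝ)) =O[Filter.atTop] (fun _ : ℕ => (1 : ℝ)) ∧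
      (fun n : ℕ => MultiPivot.expectedCost n (MultiPivot.writeAccesses k n)
          - (2 * (m : ℝ) ^ 3 - 2 * (m : ℝ) - 1) / (2 * (m : ℝ) * (2 * (m : ℝ) - 1))
            * (n : ℝ)) =O[Filter.atTop] (fun _ : ℕ => (1 : ℝ)) ∧
      (fun n : ℕ => MultiPivot.expectedCost n (MultiPivot.assignments k n)
          - (2 * (m : ℝ) ^ 3 + 3 * (m : ℝ) ^ 2 - 5 * (m : ℝ) - 2) / (2 * (m : ℝ) * (2 * (m : ℝ) - 1))
            * (n : ℝ)) =O[Filter.atTop] (fun _ : ℕ => (1 : ℝ))) := by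
  obtain rfl : m = MultiPivot.numLeft k := hm
  have hnum := MultiPivot.numLeft_eq k
  -- The coefficient `κ` is left open, so that each parity reduces to an identity between closed
  -- forms.
  have hS := fun κ => MultiPivot.expectedCost_sub_isBigO k _ _ _
    (fun n hn σ => MultiPivot.scanned_eq_splitSum hk hn σ) (κ := κ)
  have hW := fun κ => MultiPivot.expectedCost_sub_isBigO k _ _ _
    (fun n hn σ => MultiPivot.writeAccesses_eq_splitSum hn σ) (κ := κ)
  have hA := fun κ => MultiPivot.expectedCost_sub_isBigO k _ _ _
    (fun n hn σ => MultiPivot.assignments_eq_splitSum hn σ) (κ := κ)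
  constructor
  · rintro ⟨a, rfl⟩
    set m := MultiPivot.numLeft (2 * a + 1)
    have hmr : 2 * a + 1 + 1 = m + m := by omega
    have hm1 : 1 ≤ m := by omega
    have hm0 : (0 : ℝ) < m := by exact_mod_cast hm1
    refine ⟨hS _ ?_, hW _ ?_, hA _ ?_⟩
    · rw [MultiPivot.rate_scans hmr]
      field_simp
    · rw [MultiPivot.rate_writes hmr hm1 hm1, show (m : ℝ) + m = 2 * m by ring]
      field_simp
      ring
    · rw [MultiPivot.rate_assigns hmr hm1 hm1, show (m : ℝ) + m = 2 * m by ring]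
      field_simp
      ring
  · rintro ⟨a, rfl⟩
    set m := MultiPivot.numLeft (a + a)
    -- For even `k` there is one group fewer on the right; `1 ≤ k` rules out `r = 0`.
    obtain ⟨r, hr⟩ : ∃ r, m = r + 1 := ⟨a, by omega⟩
    have hmr : a + a + 1 = m + r := by omega
    have hm1 : 1 ≤ m := by omega
    have hr1 : 1 ≤ r := by omega
    have hm0 : (r : ℝ) = m - 1 := by rw [hr]; push_cast; ring
    have hm2 : (0 : ℝ) < m := by exact_mod_cast hm1
    have hm3 : (0 : ℝ) < 2 * m - 1 := by
      have : (1 : ℝ) ≤ m := by exact_mod_cast hm1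
      linarith
    have hsum : (m : ℝ) + (m - 1) = 2 * m - 1 := by ring
    have hsum' : (2 * m - 1 : ℝ) + 1 = 2 * m := by ring
    refine ⟨hS _ ?_, hW _ ?_, hA _ ?_⟩
    · rw [MultiPivot.rate_scans hmr, hm0, hsum]
      field_simp
      ring
    · rw [MultiPivot.rate_writes hmr hm1 hr1, hm0, hsum, hsum']
      field_simp
      ring
    · rw [MultiPivot.rate_assigns hmr hm1 hr1, hm0, hsum, hsum']
      field_simp
      ring
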